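/- Let $R$ be a commutative Noetherian ring of finite cohomological (i.e. global) dimension. Let $X$ be a paracompact Hausdorff space with an $n$-dimensional topological stratification $\mathfrak X$: a filtration $X=X^n\supseteq X^{n-1}\supseteq\cdots\supseteq X^0\supseteq X^{-1}=\emptyset$ by closed subsets such that every $x\in X^{n-k}-X^{n-k-1}$ has a neighborhood $N$ with a homeomorphism $\mathbb R^{n-k}\times cL\to N$ taking $\mathbb R^{n-k}\times cL^{j}$ onto $N\cap X^{n-k+j+1}$ for all $j\ge -1$, where $L$ is a compact Hausdorff space with a $(k-1)$-dimensional topological stratification $(L^j)$ and $cL$ is the open cone on $L$. (A $0$-dimensional stratified space is a countable discrete space, a $(-1)$-dimensional one is empty, and $c\emptyset$ is a point.) Assume that $X-X^{n-1}$ is dense in $X$, i.e. that $X$ is an $n$-dimensional stratified topological pseudomanifold with possibly empty pseudoboundary ($X^{n-1}\ne X^{n-2}$ is allowed), and put $\Sigma=X^{n-1}$. Let $\mathcal G$ be a local coefficient system on $X-\Sigma$, that is, a locally constant sheaf of $R$-modules with finitely generated stalks. Let $\bar p:\mathbb Z^{\ge1}\to\mathbb Z$ be a perversity, $\bar p(k)\le\bar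 p(k+1)\le\bar p(k)+1$ for all $k\geq 1$. Let $U_k=X-X^{n-k}$ with inclusions $i_k:U_k\hookrightarrow U_{k+1}$, and define the Deligne sheaf $\mathcal P^*=\mathcal P^*_{n+1}$ by $\mathcal P_1^*=\mathcal G[0]$ on $U_1=X-\Sigma$ and $\mathcal P^*_{k+1}=\tau_{\le\bar p(k)}Ri_{k*}\mathcal P^*_k$ for $1\le k\le n$. The intersection cohomology module $I^{\bar p}_{\mathfrak X}H^i(X;\mathcal G)$ is the hypercohomology $\mathbb H^i(X;\mathcal P^*)$. If $\bar p(k)\ge k-1$ for all $1\le k\le n$, then for every $i\in\mathbb Z$ there is an isomorphism of $R$-modules $$I^{\bar p}_{\mathfrak X}H^i(X;\mathcal G)\;\cong\; H^i(X-\Sigma;\mathcal G),$$ where the right-hand side is sheaf cohomology. -/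

import Mathlib

open CategoryTheory TopologicalSpace Topology

universe u

namespace Deligne

/-! ### Open cones -/

section Cone

variable (L : Type u) [TopologicalSpace L]

/-- Two points of `(L × [0,1)) ⊔ {pt}` are identified if they are equal, or if both of them are
bottom points: the points `(y, 0)` together with the extra point `pt`. The extra point only
serves to make the cone on the empty space a point. -/
def coneSetoid : Setoid ((L × Set.Ico (0 : ℝ) 1) ⊕ PUnit.{u + 1}) where
  r a b := a = b ∨
    (Sum.elim (fun z => (z.2 : ℝ)) (fun _ => 0) a = 0 ∧
      Sum.elim (fun z => (z.2 : ℝ)) (fun _ => 0) b = 0)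
  iseqv :=
    { refl := fun _ => Or.inl rfl
      symm := by
        rintro a b (h | h)
        · exact Or.inl h.symm
        · exact Or.inr ⟨h.2, h.1⟩
      trans := by
        rintro a b c (rfl | h) (rfl | h')
        · exact Or.inl rfl
        · exact Or.inr h'
        · exact Or.inr h
        · exact Or.inr ⟨h.1, h'.2⟩ }

/-- The open cone `cL = L × [0,1) / (y,0) ∼ (z,0)` with the quotient topology (and `c∅ = pt`). -/
def OpenCone : Type u := Quotient (coneSetoid L)

instance : TopologicalSpace (OpenCone L) :=
  inferInstanceAs (TopologicalSpace (Quotient (coneSetoid L)))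

variable {L}

/-- The point `[y, t]` of the open cone. -/
def OpenCone.mk (y : L) (t : Set.Ico (0 : ℝ) 1) : OpenCone L :=
  Quotient.mk (coneSetoid L) (Sum.inl (y, t))

variable (L) in
/-- The cone point. -/
def OpenCone.apex : OpenCone L := Quotient.mk (coneSetoid L) (Sum.inr PUnit.unit)

/-- If `G` is a filtration of `L`, the induced filtration of `cL`: the set in dimension `i` is
`c(G (i-1))`, that is, the cone point (for `i ≥ 0`) and all `[y, t]` with `y ∈ G (i-1)`. -/
def coneFiltration (G : ℤ → Set L) (i : ℤ) : Set (OpenCone L) :=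
  {c | (0 ≤ i ∧ c = OpenCone.apex L) ∨ ∃ y ∈ G (i - 1), ∃ t, c = OpenCone.mk y t}

end Cone

/-! ### Topological stratifications and pseudomanifolds -/

/-- `X = F n ⊇ F (n-1) ⊇ ⋯ ⊇ F 0 ⊇ F (-1) = ∅` is a filtration by closed subsets.
(Being monotone, `F` is everything above `n` and empty below `-1`.) -/
structure IsClosedFiltration {X : Type u} [TopologicalSpace X] (n : ℤ) (F : ℤ → Set X) :
    Prop where
  isClosed : ∀ i, IsClosed (F i)
  mono : Monotone F
  top : F n = Set.univ
  bot : F (-1) = ∅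

/-- `φ : ℝ^d × cL → X` is a homeomorphism onto an open neighbourhood `N` of `x`, which carries
`ℝ^d × c(G (j))` onto `N ∩ F (d + j + 1)` for all `j`. -/
structure IsDistinguishedChart {X : Type u} [TopologicalSpace X] (F : ℤ → Set X) (x : X) (d : ℕ)
    {L : Type u} [TopologicalSpace L] (G : ℤ → Set L)
    (φ : EuclideanSpace ℝ (Fin d) × OpenCone L → X) : Prop where
  isOpenEmbedding : IsOpenEmbedding φ
  mem_range : x ∈ Set.range φ
  preimage : ∀ i : ℤ, φ ⁻¹' F i = Set.univ ×ˢ coneFiltration G (i - d)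

/-- `F` is an `n`-dimensional topological stratification of the paracompact Hausdorff space `X`.
A point `x` of `X^d - X^(d-1)`, with `d + k = n`, has a distinguished neighbourhood
homeomorphic to `ℝ^d × cL`, where the link `L` is a compact Hausdorff space with a
topological stratification of dimension `k - 1`.
The dimension is allowed to be `-1`, in which case `X` is empty: this is the link for `k = 0`.
A space with a `0`-dimensional stratification is a countable discrete space. -/
def IsTopologicalStratification (n : ℤ) (X : Type u) [TopologicalSpace X] (F : ℤ → Set X) :
    Prop :=
  T2Space X ∧ ParacompactSpace X ∧ IsClosedFiltration n F ∧ (n = 0 → Countable X) ∧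
    ∀ (d k : ℕ) (_ : (d : ℤ) + k = n), ∀ x ∈ F d \ F (d - 1),
      ∃ (L : Type u) (_ : TopologicalSpace L) (G : ℤ → Set L),
        CompactSpace L ∧ T2Space L ∧ IsTopologicalStratification (k - 1) L G ∧
          ∃ φ : EuclideanSpace ℝ (Fin d) × OpenCone L → X, IsDistinguishedChart F x d G φ
termination_by (n + 1).toNat
decreasing_by omega

/-- The structure on `X` of an `n`-dimensional stratified topological pseudomanifold with
(possibly empty) pseudoboundary: a topological stratification `X = X^n ⊇ X^(n-1) ⊇ ⋯ ⊇ X^0`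
such that `X - X^(n-1)` is dense. It is not required that `X^(n-1) = X^(n-2)`. -/
structure PseudomanifoldStratification (n : ℕ) (X : Type u) [TopologicalSpace X] where
  /-- The skeleta `X^i`. -/
  skel : ℤ → Set X
  isTopologicalStratification : IsTopologicalStratification n X skel
  dense : Dense (skel (n - 1))ᶜ

namespace PseudomanifoldStratification

variable {n : ℕ} {X : Type u} [TopologicalSpace X] (S : PseudomanifoldStratification n X)

theorem isClosedFiltration : IsClosedFiltration n S.skel := by
  have h := S.isTopologicalStratification
  rw [IsTopologicalStratification] at h
  exact h.2.2.1

/-- The singular locus `Σ = X^(n-1)`. -/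
def singularLocus : Set X := S.skel (n - 1)

/-- The open subset `U_k = X - X^(n-k)`. -/
def U (k : ℕ) : Opens (TopCat.of X) :=
  ⟨(S.skel (n - k))ᶜ, (S.isClosedFiltration.isClosed _).isOpen_compl⟩

/-- `U_1` is the complement of the singular locus. -/
theorem coe_U_one : (S.U 1 : Set X) = S.singularLocusᶜ := rfl

theorem U_le_succ (k : ℕ) : S.U k ≤ S.U (k + 1) :=
  Set.compl_subset_compl.2 (S.isClosedFiltration.mono (by push_cast; omega))

/-- `U_k` as a topological space. -/
abbrev space (k : ℕ) : TopCat.{u} := (Opens.toTopCat (TopCat.of X)).obj (S.U k)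

/-- The inclusion `i_k : U_k ⟶ U_{k+1}`. -/
def incl (k : ℕ) : S.space k ⟶ S.space (k + 1) :=
  (Opens.toTopCat (TopCat.of X)).map (homOfLE (S.U_le_succ k))

end PseudomanifoldStratification

/-- A perversity: `p : ℤ^{≥ 1} → ℤ` with `p k ≤ p (k+1) ≤ p k + 1`. -/
structure Perversity where
  /-- The underlying function. -/
  toFun : ℕ+ → ℤ
  le_succ : ∀ k, toFun k ≤ toFun (k + 1)
  succ_le : ∀ k, toFun (k + 1) ≤ toFun k + 1

/-! ### Derived categories of sheaves of modules -/

section Sheaves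

attribute [local instance] HasDerivedCategory.standard

variable (R : Type u) [CommRing R]

/-- Sheaves of `R`-modules on a space. -/
abbrev Sh (Y : TopCat.{u}) := TopCat.Sheaf (ModuleCat.{u} R) Y

/-- The bounded below derived category `D⁺(R_Y)` of sheaves of `R`-modules on `Y`. -/
abbrev DPlus (Y : TopCat.{u}) := DerivedCategory.Plus (Sh R Y)

variable {R}

instance {Y Z : TopCat.{u}} (f : Y ⟶ Z) :
    (TopCat.Sheaf.pushforward (ModuleCat.{u} R) f).Additive where

/-- The derived direct image `Rf_*`. -/
noncomputable def derivedPushforward {Y Z : TopCat.{u}} (f : Y ⟶ Z) : DPlus R Y ⥤ DPlus R Z :=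
  (TopCat.Sheaf.pushforward (ModuleCat.{u} R) f).rightDerivedFunctorPlus

variable (R) in
/-- The functor of global sections `F ↦ F(Y)`. -/
def globalSections (Y : TopCat.{u}) : Sh R Y ⥤ ModuleCat.{u} R :=
  (sheafSections (Opens.grothendieckTopology Y) (ModuleCat.{u} R)).obj (Opposite.op ⊤)

instance (Y : TopCat.{u}) : (globalSections R Y).Additive where

/-- The hypercohomology `ℍ^i(Y; K)` of a complex of sheaves of `R`-modules: the cohomology in
degree `i` of `RΓ(Y; K)`. -/
noncomputable def hypercohomology {Y : TopCat.{u}} (K : DPlus R Y) (i : ℤ) : ModuleCat.{u} R :=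
  (DerivedCategory.Plus.homologyFunctor (ModuleCat.{u} R) i).obj
    ((globalSections R Y).rightDerivedFunctorPlus.obj K)

/-- A single sheaf, considered as a complex concentrated in degree `0`. -/
noncomputable def single {Y : TopCat.{u}} (G : Sh R Y) : DPlus R Y :=
  (DerivedCategory.Plus.singleFunctor (Sh R Y) 0).obj G

/-- The sheaf cohomology `H^i(Y; G)`: the cohomology of `RΓ(Y; G)`. -/
noncomputable def sheafCohomology {Y : TopCat.{u}} (G : Sh R Y) (i : ℤ) : ModuleCat.{u} R :=
  hypercohomology (single G) i

/-- The truncation `τ_{≤ m}`, for the canonical t-structure. -/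
noncomputable def trunc {Y : TopCat.{u}} (m : ℤ) : DPlus R Y ⥤ DPlus R Y :=
  (DerivedCategory.Plus.TStructure.t (C := Sh R Y)).truncLE m

/-- A local coefficient system: a locally constant sheaf of `R`-modules with finitely generated
stalks. -/
def IsLocalSystem {Y : TopCat.{u}} (G : Sh R Y) : Prop :=
  ∀ y : Y, ∃ V : Opens Y, y ∈ V ∧ ∃ M : ModuleCat.{u} R, Module.Finite R M ∧
    Nonempty (V.sheafRestrict.obj G ≅
      (constantSheaf (Opens.grothendieckTopology V) (ModuleCat.{u} R)).obj M)

variable (R) in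
/-- `R` has finite cohomological (that is, global) dimension: there is a bound for the projective
dimensions of all `R`-modules. -/
def FiniteCohomologicalDimension : Prop :=
  ∃ d : ℕ, ∀ M : ModuleCat.{u} R, HasProjectiveDimensionLE M d

/-! ### The Deligne sheaf and intersection cohomology -/

section DeligneSheaf

variable {n : ℕ} {X : Type u} [TopologicalSpace X] (S : PseudomanifoldStratification n X)
  (p : Perversity) (G : Sh R (S.space 1))

/-- The complexes `P_k` on `U_k`, indexed by `j = k - 1`: `P_1 = G[0]` and
`P_{k+1} = τ_{≤ p(k)} R(i_k)_* P_k`. -/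
noncomputable def deligneStep : (j : ℕ) → DPlus R (S.space (j + 1))
  | 0 => single G
  | j + 1 => (trunc (p.toFun j.succPNat)).obj
      ((derivedPushforward (S.incl (j + 1))).obj (deligneStep j))

/-- The Deligne sheaf `P = P_{n+1}` as a complex of sheaves on `X`. Here `U_{n+1} = X - X^{-1}` is
all of `X`, and the complex is transported along the homeomorphism `U_{n+1} ⟶ X`. -/
noncomputable def deligneSheaf : DPlus R (TopCat.of X) :=
  (derivedPushforward (S.U (n + 1)).inclusion').obj (deligneStep S p G n)

/-- The intersection cohomology module `I^p H^i(X; G)`, formed with the stratification `S`. -/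
noncomputable def intersectionCohomology (i : ℤ) : ModuleCat.{u} R :=
  hypercohomology (deligneSheaf S p G) i

end DeligneSheaf

end Sheaves

end Deligne

open Deligne

/-! The hypothesis on the perversity makes every truncation in the construction of the Deligne sheaf
harmless. Let `I` be an injective resolution of the local system on the regular part. Its direct
image to `U_{k+1}` is exact in all positive degrees `≥ k` (`exactAt_pushComplex`), so truncating at
`p k ≥ k - 1` is an isomorphism. Inductively each `P_k` is a direct image of `I`, and the global
sections of a direct image are those of `I`.

Exactness is local. Near a point of codimension `k ≥ 1` with link `L`, the regular part of a small
conical neighbourhood is `ℝ^d × (0, ε)` times the regular part of `L`. What is needed is that the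
regular part of a compact stratified space of dimension `e`, times a Euclidean space, has no
cohomology with locally constant coefficients in degrees `> e` (`linkVanishing`). This goes by
strong induction on `e`: push the resolution forward to the compact space. By induction the result
has no local cohomology in degrees `≥ max(k, 1)` at points of codimension `k`, and such local bounds
force global vanishing above the dimension (`vanAbove_of_stratification`).

The passage from local to global is a sweeping argument (`relVan_of_slices`): if all level sets of a
real function on a compact set have no cohomology above `e`, the set has none above `e + 1`. A chart
is swept by the cone radius, whose slices are the apex and copies of the link, and then by its `d`
coordinates. The same argument on boxes, followed by an exhaustion, shows that Euclidean space is
acyclic (`IsResolution.vanOn_pi`), which settles codimension `0`.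

All of this is done by hand with sections of flasque complexes. Cohomology along a closed set is
expressed by global sections and their germs, and an index `q` in a vanishing statement refers to
cohomology in degree `q + 1`. -/

namespace Deligne

universe v w

/-! ### Flasque complexes and their functoriality -/

/-- A complex of flasque sheaves of abelian groups in non-negative degrees, given by its sections
over open subsets. -/
structure FlasqueComplex (Y : Type v) [TopologicalSpace Y] where
  /-- The sections of degree `q` over an open set. -/
  obj : ℕ → Opens Y → Type w
  [grp : ∀ q V, AddCommGroup (obj q V)]
  /-- The restriction maps. -/
  res : ∀ (q : ℕ) {V W : Opens Y}, V ≤ W → obj q W →+ obj q V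
  res_self : ∀ {q : ℕ} {V : Opens Y} (h : V ≤ V) (s : obj q V), res q h s = s
  res_res : ∀ {q : ℕ} {U V W : Opens Y} (h : U ≤ V) (h' : V ≤ W) (s : obj q W),
    res q h (res q h' s) = res q (h.trans h') s
  /-- The differential. -/
  d : ∀ (q : ℕ) (V : Opens Y), obj q V →+ obj (q + 1) V
  d_d : ∀ {q : ℕ} {V : Opens Y} (s : obj q V), d (q + 1) V (d q V s) = 0
  d_res : ∀ {q : ℕ} {V W : Opens Y} (h : V ≤ W) (s : obj q W),
    d q V (res q h s) = res (q + 1) h (d q W s)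
  sep : ∀ {q : ℕ} {V : Opens Y} (s : obj q V),
    (∀ x ∈ V, ∃ (W : Opens Y) (h : W ≤ V), x ∈ W ∧ res q h s = 0) → s = 0
  glue : ∀ {q : ℕ} {ι : Type w} (V : ι → Opens Y) (U : Opens Y) (hV : ∀ i, V i ≤ U)
    (_ : ∀ x ∈ U, ∃ i, x ∈ V i) (s : ∀ i, obj q (V i)),
    (∀ i j, res q inf_le_left (s i) = res q (inf_le_right : V i ⊓ V j ≤ V j) (s j)) →
    ∃ t : obj q U, ∀ i, res q (hV i) t = s i
  flasque : ∀ {q : ℕ} {V W : Opens Y} (h : V ≤ W), Function.Surjective (res q h)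

namespace FlasqueComplex

attribute [instance] FlasqueComplex.grp

section Functoriality

variable {Y : Type v} [TopologicalSpace Y] (K : FlasqueComplex.{v, w} Y)

theorem res_inj_of_eq {q : ℕ} {V W : Opens Y} (h : V ≤ W) (h' : W ≤ V) (s t : K.obj q W)
    (e : K.res q h s = K.res q h t) : s = t := by
  have := congrArg (K.res q h') e
  rwa [K.res_res, K.res_res, K.res_self, K.res_self] at this

/-- Direct image along a continuous map. -/
@[reducible] def pushforward {Z : Type*} [TopologicalSpace Z] (f : C(Y, Z)) :
    FlasqueComplex Z where
  obj q V := K.obj q (V.comap f)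
  res q _ _ h := K.res q (fun _ hx => h hx)
  res_self _ s := K.res_self _ s
  res_res _ _ s := K.res_res _ _ s
  d q V := K.d q _
  d_d s := K.d_d s
  d_res _ s := K.d_res _ s
  sep s hs := K.sep s fun x hx => by
    obtain ⟨W, h, hxW, e⟩ := hs (f x) hx
    exact ⟨W.comap f, _, hxW, e⟩
  glue V U hV hU s hs := K.glue (fun i => (V i).comap f) (U.comap f) (fun i _ hx => hV i hx)
    (fun x hx => hU (f x) hx) s hs
  flasque _ := K.flasque _

/-- The image of an open set under an open embedding. -/
@[reducible] def imageOpens {A : Type*} [TopologicalSpace A] {φ : A → Y} (hφ : IsOpenEmbedding φ)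
    (V : Opens A) : Opens Y := ⟨φ '' V, hφ.isOpenMap _ V.2⟩

/-- Restriction along an open embedding. -/
@[reducible] def pullback {A : Type*} [TopologicalSpace A] {φ : A → Y} (hφ : IsOpenEmbedding φ) :
    FlasqueComplex A where
  obj q V := K.obj q (imageOpens hφ V)
  res q _ _ h := K.res q (Set.image_mono h)
  res_self _ s := K.res_self _ s
  res_res _ _ s := K.res_res _ _ s
  d q V := K.d q _
  d_d s := K.d_d s
  d_res _ s := K.d_res _ s
  sep s hs := K.sep s fun x hx => by
    obtain ⟨a, ha, rfl⟩ := hx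
    obtain ⟨W, h, hxW, e⟩ := hs a ha
    exact ⟨imageOpens hφ W, _, ⟨a, hxW, rfl⟩, e⟩
  glue V U hV hU s hs := by
    refine K.glue (fun i => imageOpens hφ (V i)) (imageOpens hφ U)
      (fun i => Set.image_mono (hV i)) ?_ s ?_
    · rintro _ ⟨a, ha, rfl⟩
      obtain ⟨i, hi⟩ := hU a ha
      exact ⟨i, a, hi, rfl⟩
    · intro i j
      have e : imageOpens hφ (V i ⊓ V j) = imageOpens hφ (V i) ⊓ imageOpens hφ (V j) :=
        Opens.ext (Set.image_inter hφ.injective)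
      refine K.res_inj_of_eq e.le e.ge _ _ ?_
      rw [K.res_res, K.res_res]
      exact hs i j
  flasque _ := K.flasque _

end Functoriality

variable {Y : Type v} [TopologicalSpace Y] (K : FlasqueComplex.{v, w} Y)

/-- The cohomology in degree `q + 1` vanishes at `x`: local exactness. -/
def LocEx (q : ℕ) (x : Y) : Prop :=
  ∀ (V : Opens Y), x ∈ V → ∀ α : K.obj (q + 1) V, K.d (q + 1) V α = 0 →
    ∃ (W : Opens Y) (h : W ≤ V), x ∈ W ∧ ∃ β : K.obj q W, K.d q W β = K.res (q + 1) h α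

/-- The kernel of `d` in degree `0` is locally constant. -/
def LocConst : Prop :=
  ∀ y : Y, ∃ V : Opens Y, y ∈ V ∧ ∀ (W' W : Opens Y) (h : W' ≤ W), W ≤ V →
    IsPreconnected (W : Set Y) → (W' : Set Y).Nonempty →
    (∀ s : K.obj 0 W, K.d 0 W s = 0 → K.res 0 h s = 0 → s = 0) ∧
    (IsPreconnected (W' : Set Y) → ∀ s' : K.obj 0 W', K.d 0 W' s' = 0 →
      ∃ s : K.obj 0 W, K.d 0 W s = 0 ∧ K.res 0 h s = s')

/-- The complex is a resolution of a locally constant sheaf. -/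
structure IsResolution : Prop where
  locEx : ∀ q x, K.LocEx q x
  locConst : K.LocConst

variable {K}

theorem IsResolution.pullback (hK : K.IsResolution) {A : Type*} [TopologicalSpace A] {φ : A → Y}
    (hφ : IsOpenEmbedding φ) : (K.pullback hφ).IsResolution where
  locEx q x V hx α hα := by
    obtain ⟨W, h, hxW, β, hβ⟩ := hK.locEx q (φ x) (imageOpens hφ V) ⟨x, hx, rfl⟩ α hα
    have e : imageOpens hφ (W.comap ⟨φ, hφ.continuous⟩) ≤ W := by
      rintro _ ⟨a, ha, rfl⟩
      exact ha
    refine ⟨W.comap ⟨φ, hφ.continuous⟩, ?_, hxW, K.res q e β, ?_⟩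
    · intro a ha
      obtain ⟨b, hb, e⟩ := h ha
      rwa [← hφ.injective e]
    · change K.d q _ (K.res q e β) = K.res (q + 1) _ α
      rw [K.d_res, hβ, K.res_res]
  locConst y := by
    obtain ⟨V, hy, hV⟩ := hK.locConst (φ y)
    refine ⟨V.comap ⟨φ, hφ.continuous⟩, hy, fun W' W h hW hc hne => ?_⟩
    obtain ⟨h1, h2⟩ := hV (imageOpens hφ W') (imageOpens hφ W) (Set.image_mono h)
      (by rintro _ ⟨a, ha, rfl⟩; exact hW ha) (hc.image _ hφ.continuous.continuousOn)
      (hne.image _)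
    exact ⟨h1, fun hc' => h2 (hc'.image _ hφ.continuous.continuousOn)⟩

/-! ### Global sections and relative vanishing -/

variable (K)

/-- The global section `s` vanishes near `x`. -/
def ZeroNear {q : ℕ} (s : K.obj q ⊤) (x : Y) : Prop :=
  ∃ V : Opens Y, x ∈ V ∧ K.res q (le_top : V ≤ ⊤) s = 0

variable {K}

theorem isOpen_zeroNear {q : ℕ} (s : K.obj q ⊤) : IsOpen {x | K.ZeroNear s x} := by
  rw [isOpen_iff_mem_nhds]
  rintro x ⟨V, hx, hs⟩
  exact Filter.mem_of_superset (V.2.mem_nhds hx) fun y hy => ⟨V, hy, hs⟩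

theorem zeroNear_zero {q : ℕ} (x : Y) : K.ZeroNear (0 : K.obj q ⊤) x := ⟨⊤, trivial, map_zero _⟩

theorem ZeroNear.add {q : ℕ} {s t : K.obj q ⊤} {x : Y} (hs : K.ZeroNear s x)
    (ht : K.ZeroNear t x) : K.ZeroNear (s + t) x := by
  obtain ⟨V, hV, hs⟩ := hs
  obtain ⟨W, hW, ht⟩ := ht
  refine ⟨V ⊓ W, ⟨hV, hW⟩, ?_⟩
  rw [map_add, ← K.res_res inf_le_left (le_top : V ≤ ⊤), hs,
    ← K.res_res inf_le_right (le_top : W ≤ ⊤), ht, map_zero, map_zero, add_zero]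

theorem ZeroNear.neg {q : ℕ} {s : K.obj q ⊤} {x : Y} (hs : K.ZeroNear s x) :
    K.ZeroNear (-s) x := by
  obtain ⟨V, hV, hs⟩ := hs
  exact ⟨V, hV, by rw [map_neg, hs, neg_zero]⟩

theorem ZeroNear.sub {q : ℕ} {s t : K.obj q ⊤} {x : Y} (hs : K.ZeroNear s x)
    (ht : K.ZeroNear t x) : K.ZeroNear (s - t) x := by
  rw [sub_eq_add_neg]
  exact hs.add ht.neg

theorem ZeroNear.d {q : ℕ} {s : K.obj q ⊤} {x : Y} (hs : K.ZeroNear s x) :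
    K.ZeroNear (K.d q ⊤ s) x := by
  obtain ⟨V, hV, hs⟩ := hs
  exact ⟨V, hV, by rw [← K.d_res, hs, map_zero]⟩

theorem eq_zero_of_zeroNear {q : ℕ} {s : K.obj q ⊤} (h : ∀ x, K.ZeroNear s x) : s = 0 :=
  K.sep s fun x _ => by
    obtain ⟨V, hx, hs⟩ := h x
    exact ⟨V, le_top, hx, hs⟩

theorem res_eq_zero_of_zeroNear {q : ℕ} {s : K.obj q ⊤} {V : Opens Y}
    (h : ∀ x ∈ V, K.ZeroNear s x) : K.res q (le_top : V ≤ ⊤) s = 0 :=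
  K.sep _ fun x hx => by
    obtain ⟨W, hxW, hs⟩ := h x hx
    refine ⟨W ⊓ V, inf_le_right, ⟨hxW, hx⟩, ?_⟩
    rw [K.res_res, ← K.res_res inf_le_left (le_top : W ≤ ⊤), hs, map_zero]

/-- A section over two open sets can be glued. -/
theorem glue_two {q : ℕ} {V W : Opens Y} (s : K.obj q V) (t : K.obj q W)
    (h : K.res q inf_le_left s = K.res q (inf_le_right : V ⊓ W ≤ W) t) :
    ∃ r : K.obj q (V ⊔ W), K.res q le_sup_left r = s ∧ K.res q le_sup_right r = t := by
  let F : ULift.{w} Bool → Opens Y := fun b => bif b.down then V else W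
  let σ : ∀ b, K.obj q (F b) := fun b => match b with
    | ⟨true⟩ => s
    | ⟨false⟩ => t
  obtain ⟨r, hr⟩ := K.glue F (V ⊔ W)
    (by rintro ⟨_ | _⟩; exacts [le_sup_right, le_sup_left])
    (by
      rintro x (hx | hx)
      exacts [⟨⟨true⟩, hx⟩, ⟨⟨false⟩, hx⟩]) σ (by
      rintro ⟨_ | _⟩ ⟨_ | _⟩
      · rfl
      · have := congrArg (K.res q (le_of_eq (inf_comm W V))) h
        rw [K.res_res, K.res_res] at this
        exact this.symm
      · exact h
      · rfl)
  exact ⟨r, hr ⟨true⟩, hr ⟨false⟩⟩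

/-- Global sections on a normal space are soft. -/
theorem exists_cutoff [NormalSpace Y] {q : ℕ} (s : K.obj q ⊤) {A C : Set Y} (hA : IsClosed A)
    (hC : IsClosed C) (h : ∀ x ∈ A, x ∈ C → K.ZeroNear s x) :
    ∃ t : K.obj q ⊤, (∀ x ∈ A, K.ZeroNear (t - s) x) ∧ ∀ x ∈ C, K.ZeroNear t x := by
  -- On `Z` the section `s` already agrees locally with `0`, so only the part of `A` outside `Z` has
  -- to be separated from `C`. The glued section is `s` on `P` and `0` on `Q ∪ Z`.
  let Z : Opens Y := ⟨{x | K.ZeroNear s x}, isOpen_zeroNear s⟩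
  obtain ⟨P, Q, hP, hQ, hAP, hCQ, hPQ⟩ := normal_separation (s := A ∩ (Z : Set Y)ᶜ) (t := C)
    (hA.inter Z.2.isClosed_compl) hC (by
      rw [Set.disjoint_left]
      rintro x ⟨hx, hx'⟩ hxC
      exact hx' (h x hx hxC))
  let P' : Opens Y := ⟨P, hP⟩
  let Q' : Opens Y := ⟨Q, hQ⟩
  obtain ⟨r, hr, hr'⟩ := K.glue_two (V := P') (W := Q' ⊔ Z) (K.res q le_top s) 0 (by
    rw [map_zero, K.res_res]
    refine res_eq_zero_of_zeroNear ?_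
    rintro x ⟨hx, hx' | hx'⟩
    · exact (Set.disjoint_left.1 hPQ hx hx').elim
    · exact hx')
  obtain ⟨t, ht⟩ := K.flasque (le_top : P' ⊔ (Q' ⊔ Z) ≤ ⊤) r
  have h1 : K.res q (le_top : P' ≤ ⊤) t = K.res q le_top s := by
    rw [← hr, ← ht, K.res_res]
  have h2 : K.res q (le_top : Q' ⊔ Z ≤ ⊤) t = 0 := by
    rw [← hr', ← ht, K.res_res]
  have h3 : ∀ x ∈ Q' ⊔ Z, K.ZeroNear t x := fun x hx => ⟨_, hx, h2⟩
  refine ⟨t, fun x hx => ?_, fun x hx => h3 x (Or.inl (hCQ hx))⟩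
  by_cases hxZ : x ∈ Z
  · exact (h3 x (Or.inr hxZ)).sub hxZ
  · exact ⟨P', hAP ⟨hx, hxZ⟩, by rw [map_sub, h1, sub_self]⟩

variable (K)

/-- Vanishing in degree `q + 1` of the cohomology of `A` relative to `C`. -/
def RelVan (q : ℕ) (A C : Set Y) : Prop :=
  ∀ δ : K.obj (q + 1) ⊤, (∀ x ∈ A, K.ZeroNear (K.d (q + 1) ⊤ δ) x) → (∀ x ∈ C, K.ZeroNear δ x) →
    ∃ b : K.obj q ⊤, (∀ x ∈ C, K.ZeroNear b x) ∧ ∀ x ∈ A, K.ZeroNear (K.d q ⊤ b - δ) x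

/-- Cocycles of degree `q` near `A` which vanish near `C` extend to cocycles near `S`. -/
def RelExt (q : ℕ) (A S C : Set Y) : Prop :=
  ∀ c : K.obj q ⊤, (∀ x ∈ A, K.ZeroNear (K.d q ⊤ c) x) → (∀ x ∈ C, K.ZeroNear c x) →
    ∃ c' : K.obj q ⊤, (∀ x ∈ S, K.ZeroNear (K.d q ⊤ c') x) ∧ (∀ x ∈ C, K.ZeroNear c' x) ∧
      ∀ x ∈ A, K.ZeroNear (c' - c) x

/-- The cohomology of `A` relative to any closed set vanishes in degrees `> e`. -/
def VanAbove (e : ℕ) (A : Set Y) : Prop :=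
  ∀ q, e ≤ q → ∀ C, IsClosed C → K.RelVan q A C

variable {K}

/-- Near `A` the cocycle equals some `d b`, and `d b` is a cocycle everywhere. -/
theorem RelVan.relExt {q : ℕ} {A C : Set Y} (h : K.RelVan q A C) (S : Set Y) :
    K.RelExt (q + 1) A S C := by
  intro c hc hC
  obtain ⟨b, hb, hb'⟩ := h c hc hC
  exact ⟨K.d q ⊤ b, fun x _ => by rw [K.d_d]; exact zeroNear_zero x, fun x hx => (hb x hx).d, hb'⟩

theorem relVan_empty (q : ℕ) (C : Set Y) : K.RelVan q ∅ C :=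
  fun _ _ _ => ⟨0, fun x _ => zeroNear_zero x, by simp⟩

theorem relExt_empty (q : ℕ) (S C : Set Y) : K.RelExt q ∅ S C :=
  fun _ _ _ => ⟨0, fun x _ => by rw [map_zero]; exact zeroNear_zero x,
    fun x _ => zeroNear_zero x, by simp⟩

theorem vanAbove_empty (e : ℕ) : K.VanAbove e ∅ := fun q _ C _ => relVan_empty q C

/-- After subtracting a primitive near `A`, the remaining problem on `B` is relative to `A ∪ C`.
This is why `VanAbove` quantifies over all closed `C`. -/
theorem VanAbove.union {e : ℕ} {A B : Set Y} (cA : IsClosed A) (hA : K.VanAbove e A)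
    (hB : K.VanAbove e B) : K.VanAbove e (A ∪ B) := by
  intro q hq C hC δ hδ hδ'
  obtain ⟨b, hb, hb'⟩ := hA q hq C hC δ (fun x hx => hδ x (Or.inl hx)) hδ'
  obtain ⟨b', hb1, hb2⟩ := hB q hq (A ∪ C) (cA.union hC) (δ - K.d q ⊤ b)
    (fun x hx => by rw [map_sub, K.d_d, sub_zero]; exact hδ x (Or.inr hx))
    (by
      rintro x (hx | hx)
      · rw [← neg_sub]; exact (hb' x hx).neg
      · exact (hδ' x hx).sub (hb x hx).d)
  refine ⟨b + b', fun x hx => (hb x hx).add (hb1 x (Or.inr hx)), ?_⟩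
  rintro x (hx | hx)
  · have := (hb' x hx).add (hb1 x (Or.inl hx)).d
    rwa [map_add, add_sub_right_comm]
  · have := hb2 x hx
    rwa [sub_sub_eq_add_sub, ← map_add, add_comm b' b] at this

theorem VanAbove.biUnion {e : ℕ} {ι : Type*} (t : Finset ι) {A : ι → Set Y}
    (cA : ∀ i ∈ t, IsClosed (A i)) (hA : ∀ i ∈ t, K.VanAbove e (A i)) :
    K.VanAbove e (⋃ i ∈ t, A i) := by
  classical
  induction t using Finset.induction_on with
  | empty => simpa using vanAbove_empty e
  | insert i t _ ih =>
    rw [Finset.set_biUnion_insert]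
    exact VanAbove.union (cA i (by simp)) (hA i (by simp))
      (ih (fun j hj => cA j (by simp [hj])) fun j hj => hA j (by simp [hj]))

/-- If `x ∈ C`, the zero section is a primitive. Otherwise a local primitive extends globally by
flasqueness and can be cut off near `C` without changing its germ at `x`. -/
theorem LocEx.relVan [NormalSpace Y] [T1Space Y] {q : ℕ} {x : Y} (h : K.LocEx q x) {C : Set Y}
    (hC : IsClosed C) : K.RelVan q {x} C := by
  intro δ hδ hδ'
  simp only [Set.mem_singleton_iff, forall_eq] at hδ ⊢
  by_cases hx : x ∈ C
  · refine ⟨0, fun x _ => zeroNear_zero x, ?_⟩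
    rw [map_zero]
    exact (zeroNear_zero x).sub (hδ' x hx)
  · obtain ⟨V, hxV, hV⟩ := hδ
    obtain ⟨W, hW, hxW, β, hβ⟩ := h V hxV (K.res _ le_top δ) (by rw [K.d_res, hV])
    obtain ⟨b, rfl⟩ := K.flasque (le_top : W ≤ ⊤) β
    obtain ⟨b', hb, hb'⟩ := exists_cutoff b isClosed_singleton hC (A := {x}) (by
      rintro _ rfl hxC; exact (hx hxC).elim)
    refine ⟨b', hb', ?_⟩
    have h1 := (hb x rfl).d
    have h2 : K.ZeroNear (K.d q ⊤ b - δ) x := ⟨W, hxW, by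
      rw [map_sub, ← K.d_res, hβ, K.res_res, sub_self]⟩
    have := h1.add h2
    rwa [map_sub, sub_add_sub_cancel] at this

theorem vanAbove_singleton [NormalSpace Y] [T1Space Y] {e : ℕ} {x : Y}
    (h : ∀ q, e ≤ q → K.LocEx q x) : K.VanAbove e {x} :=
  fun q hq _ hC => (h q hq).relVan hC

/-- The sweeping lemma: vanishing for all slices of a continuous function. -/
theorem relVan_of_slices [NormalSpace Y] [T2Space Y] {q : ℕ} {B : Type*} [TopologicalSpace B]
    {E : Set B} (hE : IsCompact E) {g : B → Y} (hg : ContinuousOn g E) (hg' : Set.InjOn g E)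
    {f : B → ℝ} (hf : ContinuousOn f E) {C : Set Y} (hC : IsClosed C)
    (h1 : ∀ t, K.RelVan q (g '' (E ∩ f ⁻¹' {t})) C)
    (h2 : ∀ t, K.RelExt q (g '' (E ∩ f ⁻¹' {t})) (g '' E) C) :
    K.RelVan q (g '' E) C := by
  intro δ hδ hδ'
  have cpt : ∀ F : Set ℝ, IsClosed F → IsCompact (g '' (E ∩ f ⁻¹' F)) := fun F hF => by
    obtain ⟨u, hu, e⟩ := continuousOn_iff_isClosed.1 hf F hF
    have : IsCompact (E ∩ f ⁻¹' F) := by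
      rw [Set.inter_comm, e]
      exact hE.inter_left hu
    exact this.image_of_continuousOn (hg.mono Set.inter_subset_left)
  -- `P t` says that `δ` has a primitive near the sublevel set `f ≤ t`. By `step`, the set of such
  -- `t` cannot have a finite supremum.
  let P : ℝ → Prop := fun t => ∃ b : K.obj q ⊤, (∀ x ∈ C, K.ZeroNear b x) ∧
    ∀ x ∈ g '' (E ∩ f ⁻¹' Set.Iic t), K.ZeroNear (K.d q ⊤ b - δ) x
  have hP : ∀ s t, s ≤ t → P t → P s := by
    rintro s t hst ⟨b, hb, hb'⟩
    refine ⟨b, hb, fun x hx => hb' x (Set.image_mono ?_ hx)⟩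
    exact Set.inter_subset_inter_right _ (Set.preimage_mono (Set.Iic_subset_Iic.2 hst))
  have step : ∀ t, ∃ ε > 0, P (t - ε) → P (t + ε) := by
    intro t
    obtain ⟨bt, hbt, hbt'⟩ := h1 t δ (fun x hx => hδ x (Set.image_mono Set.inter_subset_left hx)) hδ'
    let O : Set Y := {x | K.ZeroNear (K.d q ⊤ bt - δ) x}
    have hO : IsOpen O := isOpen_zeroNear _
    have hbad : IsClosed (f '' (E ∩ g ⁻¹' Oᶜ)) := by
      obtain ⟨u, hu, e⟩ := continuousOn_iff_isClosed.1 hg Oᶜ hO.isClosed_compl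
      have : IsCompact (E ∩ g ⁻¹' Oᶜ) := by
        rw [Set.inter_comm, e]
        exact hE.inter_left hu
      exact (this.image_of_continuousOn (hf.mono Set.inter_subset_left)).isClosed
    have ht : t ∈ (f '' (E ∩ g ⁻¹' Oᶜ))ᶜ := by
      rintro ⟨b, ⟨hb, hb'⟩, rfl⟩
      exact hb' (hbt' _ ⟨b, ⟨hb, rfl⟩, rfl⟩)
    obtain ⟨ε, hε, hball⟩ := Metric.isOpen_iff.1 hbad.isOpen_compl t ht
    have hgood : ∀ b ∈ E, |f b - t| ≤ ε / 2 → g b ∈ O := by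
      intro b hb hbt
      by_contra hn
      refine hball (?_ : f b ∈ _) ⟨b, ⟨hb, hn⟩, rfl⟩
      rw [Metric.mem_ball, Real.dist_eq]
      linarith
    refine ⟨ε / 2, half_pos hε, ?_⟩
    rintro ⟨b, hb, hb'⟩
    set s := t - ε / 2 with hs
    have slice : ∀ x ∈ g '' (E ∩ f ⁻¹' {s}), x ∈ O := by
      rintro _ ⟨y, ⟨hy, hy'⟩, rfl⟩
      refine hgood y hy ?_
      rw [Set.mem_preimage, Set.mem_singleton_iff] at hy'
      rw [hy', hs, abs_le]
      constructor <;> linarith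
    -- The two primitives differ by a cocycle near the slice `f = s`. Adding an extension `c` of it
    -- to `b` makes them agree there and leaves the coboundary unchanged near all of `g '' E`.
    obtain ⟨c, hc, hc', hc''⟩ := h2 s (bt - b) (fun x hx => by
        have h := (slice x hx : K.ZeroNear _ x).sub (hb' x (Set.image_mono
          (Set.inter_subset_inter_right _ (Set.preimage_mono (by simp))) hx))
        rwa [sub_sub_sub_cancel_right, ← map_sub] at h)
      (fun x hx => (hbt x hx).sub (hb x hx))
    -- The correction `r` turns `b + c` into `bt` on the band above `s` and is zero below `s`; the
    -- prescriptions are compatible on the common slice.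
    obtain ⟨r, hr, hr'⟩ := exists_cutoff (bt - (b + c))
      (A := g '' (E ∩ f ⁻¹' Set.Icc s (t + ε / 2))) (C := g '' (E ∩ f ⁻¹' Set.Iic s) ∪ C)
      (cpt _ isClosed_Icc).isClosed ((cpt _ isClosed_Iic).isClosed.union hC) (by
        rintro x ⟨y, ⟨hy, hys⟩, rfl⟩ (⟨z, ⟨hz, hzs⟩, e⟩ | hx)
        · obtain rfl : z = y := hg' hz hy e
          have h : K.ZeroNear (c - (bt - b)) (g z) :=
            hc'' _ ⟨z, ⟨hz, le_antisymm hzs hys.1⟩, rfl⟩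
          have := h.neg
          rwa [neg_sub, sub_sub] at this
        · exact (hbt _ hx).sub ((hb _ hx).add (hc' _ hx)))
    refine ⟨b + c + r, fun x hx => ((hb x hx).add (hc' x hx)).add (hr' x (Or.inr hx)), ?_⟩
    rintro x ⟨y, ⟨hy, hyt⟩, rfl⟩
    rcases le_total (f y) s with h | h
    · have e1 := hb' (g y) ⟨y, ⟨hy, h⟩, rfl⟩
      have e2 := hc (g y) ⟨y, hy, rfl⟩
      have e3 := (hr' (g y) (Or.inl ⟨y, ⟨hy, h⟩, rfl⟩)).d
      have := (e1.add e2).add e3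
      rwa [show K.d q ⊤ b - δ + K.d q ⊤ c + K.d q ⊤ r = K.d q ⊤ (b + c + r) - δ by
        rw [map_add, map_add]; abel] at this
    · have e1 := (hr (g y) ⟨y, ⟨hy, h, hyt⟩, rfl⟩).d
      have e2 : K.ZeroNear (K.d q ⊤ bt - δ) (g y) := hgood y hy (by
        rw [hs] at h
        rw [Set.mem_preimage, Set.mem_Iic] at hyt
        rw [abs_le]; constructor <;> linarith)
      have := e1.add e2
      rwa [show K.d q ⊤ (r - (bt - (b + c))) + (K.d q ⊤ bt - δ) = K.d q ⊤ (b + c + r) - δ by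
        simp only [map_add, map_sub]; abel] at this
  have hall : ∀ t, P t := by
    by_contra! hne
    obtain ⟨t₁, ht₁⟩ := hne
    have hbdd : BddAbove {t | P t} :=
      ⟨t₁, fun t ht => le_of_not_ge fun h => ht₁ (hP _ _ h ht)⟩
    have hnon : {t | P t}.Nonempty := by
      obtain ⟨m, hm⟩ := (hE.image_of_continuousOn hf).bddBelow
      refine ⟨m - 1, 0, fun x _ => zeroNear_zero x, ?_⟩
      rintro x ⟨y, ⟨hy, hy'⟩, rfl⟩
      have := hm ⟨y, hy, rfl⟩
      rw [Set.mem_preimage, Set.mem_Iic] at hy'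
      linarith
    obtain ⟨ε, hε, h⟩ := step (sSup {t | P t})
    obtain ⟨t, ht, htε⟩ := exists_lt_of_lt_csSup hnon (sub_lt_self _ hε)
    have := le_csSup hbdd (h (hP _ _ htε.le ht))
    linarith
  obtain ⟨M, hM⟩ := (hE.image_of_continuousOn hf).bddAbove
  obtain ⟨b, hb, hb'⟩ := hall M
  exact ⟨b, hb, fun x ⟨y, hy, e⟩ => hb' x ⟨y, ⟨hy, hM ⟨y, hy, rfl⟩⟩, e⟩⟩

/-- The extension of cocycles demanded by the sweep comes from vanishing on the slices one degree
lower. This costs one degree, hence `e + 1`. -/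
theorem vanAbove_of_slices [NormalSpace Y] [T2Space Y] {e : ℕ} {B : Type*} [TopologicalSpace B]
    {E : Set B} (hE : IsCompact E) {g : B → Y} (hg : ContinuousOn g E) (hg' : Set.InjOn g E)
    {f : B → ℝ} (hf : ContinuousOn f E)
    (h : ∀ t, K.VanAbove e (g '' (E ∩ f ⁻¹' {t}))) :
    K.VanAbove (e + 1) (g '' E) := by
  intro q hq C hC
  obtain ⟨q, rfl⟩ : ∃ r, q = r + 1 := ⟨q - 1, by omega⟩
  exact relVan_of_slices hE hg hg' hf hC (fun t => h t _ (by omega) C hC)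
    (fun t => (h t q (by omega) C hC).relExt _)

end FlasqueComplex

/-! ### Identity principle and continuation of cocycles of degree 0 -/

namespace FlasqueComplex

section IdentityPrinciple

variable {Y : Type v} [TopologicalSpace Y] {K : FlasqueComplex.{v, w} Y}

/-- The locus where `s` vanishes is open. It is also closed in `A`, since at a limit point a small
connected neighbourhood meets it and restriction of cocycles to a nonempty open subset is injective
there. -/
theorem LocConst.zeroNear_of_isPreconnected [LocallyConnectedSpace Y] (hK : K.LocConst)
    {A : Set Y} (hA : IsPreconnected A) {s : K.obj 0 ⊤} (hs : ∀ x ∈ A, K.ZeroNear (K.d 0 ⊤ s) x)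
    {x₀ : Y} (hx₀ : x₀ ∈ A) (h₀ : K.ZeroNear s x₀) {x : Y} (hx : x ∈ A) : K.ZeroNear s x := by
  refine hA.subset_of_closure_inter_subset (isOpen_zeroNear s) ⟨x₀, hx₀, h₀⟩ ?_ hx
  rintro y ⟨hy, hyA⟩
  obtain ⟨U, hyU, hU⟩ := hs y hyA
  obtain ⟨V, hyV, hV⟩ := hK y
  obtain ⟨N, hN, hN', hyN, hNc⟩ := locallyConnectedSpace_iff_subsets_isOpen_isConnected.1
    inferInstance y (U ⊓ V) ((U ⊓ V).2.mem_nhds ⟨hyU, hyV⟩)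
  obtain ⟨z, hzN, V', hzV', hz⟩ := mem_closure_iff.1 hy N hN' hyN
  let N' : Opens Y := ⟨N, hN'⟩
  refine ⟨N', hyN, (hV (V' ⊓ N') N' inf_le_right (fun a ha => (hN ha).2) hNc.isPreconnected
    ⟨z, hzV', hzN⟩).1 _ ?_ ?_⟩
  · rw [K.d_res, ← K.res_res (fun a ha => (hN ha).1 : N' ≤ U) le_top, hU, map_zero]
  · rw [K.res_res, ← K.res_res inf_le_left (le_top : V' ≤ ⊤), hz, map_zero]

end IdentityPrinciple

section NormedSpace

variable {E : Type} [NormedAddCommGroup E] [NormedSpace ℝ E] {K : FlasqueComplex.{0, w} E}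

/-- A germ of the kernel of `d` can be continued along a segment. -/
theorem LocConst.continue_along (hK : K.LocConst) (x₀ x : E) (c : K.obj 0 ⊤)
    (hc : K.ZeroNear (K.d 0 ⊤ c) x₀) :
    ∃ (V : Opens E) (s : K.obj 0 ⊤), Convex ℝ (V : Set E) ∧ x₀ ∈ V ∧ x ∈ V ∧
      (∀ y ∈ V, K.ZeroNear (K.d 0 ⊤ s) y) ∧ K.ZeroNear (s - c) x₀ := by
  choose V hV hV' using hK
  obtain ⟨U, hxU, hU⟩ := hc
  have hcpt : IsCompact (segment ℝ x₀ x) := by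
    rw [segment_eq_image']
    exact isCompact_Icc.image (by fun_prop)
  obtain ⟨δ, hδ, hball⟩ := lebesgue_number_lemma_of_metric hcpt (c := fun y => (V y : Set E))
    (fun y => (V y).2) (fun y _ => Set.mem_iUnion.2 ⟨y, hV y⟩)
  obtain ⟨r, hr, hrU⟩ := Metric.isOpen_iff.1 U.2 x₀ hxU
  -- The bound `δ / 2` keeps the thickening of each short segment inside one member of the cover;
  -- the bound `r` puts the first thickening, a ball about `x₀`, inside `U`.
  set ε := min (δ / 2) r with hε
  have hε0 : 0 < ε := lt_min (half_pos hδ) hr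
  obtain ⟨n, hn⟩ := exists_nat_gt (dist x₀ x / (δ / 2))
  have hn0 : (0 : ℝ) < n := lt_of_le_of_lt (by positivity) hn
  let γ : ℕ → E := fun k => AffineMap.lineMap x₀ x ((k : ℝ) / n)
  have γ0 : γ 0 = x₀ := by simp [γ]
  have γn : γ n = x := by simp [γ, hn0.ne']
  have γmem : ∀ k ≤ n, γ k ∈ segment ℝ x₀ x := fun k hk => by
    rw [segment_eq_image_lineMap]
    exact ⟨_, ⟨by positivity, (div_le_one hn0).2 (by exact_mod_cast hk)⟩, rfl⟩
  have γdist : ∀ k, dist (γ k) (γ (k + 1)) < δ / 2 := fun k => by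
    simp only [γ, dist_lineMap_lineMap, Real.dist_eq]
    rw [div_lt_iff₀ (half_pos hδ)] at hn
    rw [show |(k : ℝ) / n - ((k + 1 : ℕ) : ℝ) / n| = 1 / n by
      push_cast
      rw [← sub_div, abs_div, abs_of_pos hn0]; simp]
    rw [div_mul_eq_mul_div, one_mul, div_lt_iff₀ hn0]
    linarith
  let T : ℕ → Opens E := fun k => ⟨Metric.thickening ε (segment ℝ x₀ (γ k)),
    Metric.isOpen_thickening⟩
  have hT : ∀ k, Convex ℝ (T k : Set E) := fun k => (convex_segment _ _).thickening _
  have hmem : ∀ k, x₀ ∈ T k ∧ γ k ∈ T k := fun k =>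
    ⟨Metric.self_subset_thickening hε0 _ (left_mem_segment _ _ _),
      Metric.self_subset_thickening hε0 _ (right_mem_segment _ _ _)⟩
  have key : ∀ k ≤ n, ∃ s : K.obj 0 ⊤, (∀ y ∈ T k, K.ZeroNear (K.d 0 ⊤ s) y) ∧
      K.ZeroNear (s - c) x₀ := by
    intro k
    induction k with
    | zero =>
      intro _
      refine ⟨c, fun y hy => ⟨U, hrU ?_, hU⟩, by rw [sub_self]; exact zeroNear_zero _⟩
      have : y ∈ Metric.thickening ε (segment ℝ x₀ (γ 0)) := hy
      rw [γ0, segment_same, Metric.thickening_singleton] at this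
      exact Metric.ball_subset_ball (min_le_right _ _) this
    | succ k ih =>
      intro hk
      obtain ⟨s, hs, hs'⟩ := ih (by omega)
      let W : Opens E := ⟨Metric.thickening ε (segment ℝ (γ k) (γ (k + 1))),
        Metric.isOpen_thickening⟩
      have hW : Convex ℝ (W : Set E) := (convex_segment _ _).thickening _
      have hkW : γ k ∈ W := Metric.self_subset_thickening hε0 _ (left_mem_segment _ _ _)
      obtain ⟨y, hy⟩ := hball (γ k) (γmem k (by omega))
      have hWV : W ≤ V y := by
        intro z hz
        obtain ⟨a, ha, hza⟩ := Metric.mem_thickening_iff.1 hz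
        refine hy ?_
        have h1 : dist a (γ k) ≤ dist (γ k) (γ (k + 1)) := by
          rw [dist_comm a]
          have := (convex_closedBall (γ k) (dist (γ k) (γ (k + 1)))).segment_subset
            (Metric.mem_closedBall_self dist_nonneg) (by rw [Metric.mem_closedBall, dist_comm]) ha
          rwa [Metric.mem_closedBall, dist_comm] at this
        have h2 : ε ≤ δ / 2 := min_le_left _ _
        rw [Metric.mem_ball]
        linarith [dist_triangle z a (γ k), γdist k]
      -- `T k ⊓ W` is convex, hence connected, so the cocycle extends from it to `W` and can be
      -- glued.
      obtain ⟨r, hr, hr'⟩ := (hV' y (T k ⊓ W) W inf_le_right hWV hW.isPreconnected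
        ⟨γ k, (hmem k).2, hkW⟩).2 ((hT k).inter hW).isPreconnected (K.res 0 le_top s) (by
          rw [K.d_res]
          exact res_eq_zero_of_zeroNear fun z hz => hs z hz.1)
      obtain ⟨t, ht, ht'⟩ := K.glue_two (K.res 0 (le_top : T k ≤ ⊤) s) r (by
        rw [hr', K.res_res])
      obtain ⟨t, rfl⟩ := K.flasque (le_top : T k ⊔ W ≤ ⊤) t
      rw [K.res_res] at ht ht'
      refine ⟨t, ?_, ?_⟩
      · have h1 : T (k + 1) ≤ T k ⊔ W := by
          intro z hz
          obtain ⟨a, ha, hza⟩ := Metric.mem_thickening_iff.1 hz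
          have : a ∈ segment ℝ x₀ (γ k) ∪ segment ℝ (γ k) (γ (k + 1)) := by
            rw [segment_eq_image_lineMap] at ha
            obtain ⟨τ, ⟨h0, h1⟩, rfl⟩ := ha
            have e : ∀ σ : ℝ, AffineMap.lineMap x₀ (γ (k + 1)) σ =
                AffineMap.lineMap x₀ x (σ * (((k + 1 : ℕ) : ℝ) / n)) := fun σ => by
              simp only [γ, AffineMap.lineMap_apply, vsub_eq_sub, vadd_eq_add, smul_smul,
                add_sub_cancel_right]
            have hk0 : (0 : ℝ) < (k + 1 : ℕ) := by positivity
            rcases le_total (τ * ((k + 1 : ℕ) : ℝ)) k with h | h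
            · left
              rcases Nat.eq_zero_or_pos k with rfl | hkp
              · have : τ = 0 := le_antisymm (by simpa using h) h0
                rw [this, AffineMap.lineMap_apply_zero]
                exact left_mem_segment _ _ _
              · have hkp' : (0 : ℝ) < k := by exact_mod_cast hkp
                rw [segment_eq_image_lineMap]
                refine ⟨τ * ((k + 1 : ℕ) : ℝ) / k, ⟨by positivity, (div_le_one hkp').2 h⟩, ?_⟩
                rw [e]
                simp only [γ, AffineMap.lineMap_apply, vsub_eq_sub, vadd_eq_add, smul_smul,
                  add_sub_cancel_right]
                congr 2
                field_simp
            · right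
              rw [segment_eq_image_lineMap]
              refine ⟨τ * ((k + 1 : ℕ) : ℝ) - k, ⟨by linarith, ?_⟩, ?_⟩
              · have : τ * ((k + 1 : ℕ) : ℝ) ≤ (k + 1 : ℕ) := by nlinarith
                push_cast at this ⊢
                linarith
              · rw [e]
                simp only [γ, AffineMap.lineMap_apply, vsub_eq_sub, vadd_eq_add,
                  add_sub_add_right_eq_sub, ← sub_smul, smul_smul, ← add_assoc, ← add_smul]
                congr 2
                push_cast
                field_simp
                ring
          rcases this with ha | ha
          · exact Or.inl (Metric.mem_thickening_iff.2 ⟨a, ha, hza⟩)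
          · exact Or.inr (Metric.mem_thickening_iff.2 ⟨a, ha, hza⟩)
        intro z hz
        rcases h1 hz with h | h
        · refine ⟨T k, h, ?_⟩
          rw [← K.d_res, ht, K.d_res]
          exact res_eq_zero_of_zeroNear hs
        · exact ⟨W, h, by rw [← K.d_res, ht', hr]⟩
      · have : K.ZeroNear (t - s) x₀ := ⟨T k, (hmem k).1, by rw [map_sub, ht, sub_self]⟩
        simpa using this.add hs'
  obtain ⟨s, hs, hs'⟩ := key n le_rfl
  exact ⟨T n, s, hT n, (hmem n).1, γn ▸ (hmem n).2, hs, hs'⟩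

/-- A germ of the kernel of `d` extends to a global section. -/
theorem LocConst.exists_extension (hK : K.LocConst) (x₀ : E) (c : K.obj 0 ⊤)
    (hc : K.ZeroNear (K.d 0 ⊤ c) x₀) :
    ∃ s : K.obj 0 ⊤, K.d 0 ⊤ s = 0 ∧ K.ZeroNear (s - c) x₀ := by
  choose V s hconv h₀ hx hs hsc using fun x => hK.continue_along x₀ x c hc
  -- Two continuations share their germ at `x₀`, and their domains meet in a convex set containing
  -- `x₀`; no monodromy can occur.
  have cmp : ∀ x y, ∀ z ∈ V x ⊓ V y, K.ZeroNear (s x - s y) z := fun x y z hz =>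
    hK.zeroNear_of_isPreconnected ((hconv x).inter (hconv y)).isPreconnected
      (fun a ha => by rw [map_sub]; exact (hs x a ha.1).sub (hs y a ha.2)) ⟨h₀ x, h₀ y⟩
      (by have := (hsc x).sub (hsc y); rwa [sub_sub_sub_cancel_right] at this) hz
  obtain ⟨t, ht⟩ := K.glue (ι := ULift.{w} E) (fun x => V x.down) ⊤ (fun _ => le_top)
    (fun x _ => ⟨⟨x⟩, hx x⟩) (fun x => K.res 0 le_top (s x.down)) (fun x y => by
      rw [K.res_res, K.res_res, ← sub_eq_zero, ← map_sub]
      exact res_eq_zero_of_zeroNear (cmp _ _))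
  refine ⟨t, eq_zero_of_zeroNear fun x => ⟨V x, hx x, ?_⟩, ?_⟩
  · rw [← K.d_res, ht ⟨x⟩, K.d_res]
    exact res_eq_zero_of_zeroNear (hs x)
  · have : K.ZeroNear (t - s x₀) x₀ := ⟨V x₀, h₀ x₀, by rw [map_sub, ht ⟨x₀⟩, sub_self]⟩
    simpa using this.add (hsc x₀)

/-- The germ of the cocycle at one point extends to a global cocycle, which agrees with it along the
connected set `A` by the identity principle. In degree 0 this replaces `RelVan.relExt`. -/
theorem LocConst.relExt_zero (hK : K.LocConst) {A : Set E} (hA : IsPreconnected A) (S : Set E) :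
    K.RelExt 0 A S ∅ := by
  rcases A.eq_empty_or_nonempty with rfl | ⟨x₀, hx₀⟩
  · exact relExt_empty _ _ _
  intro c hc _
  obtain ⟨s, hs, hsc⟩ := hK.exists_extension x₀ c (hc x₀ hx₀)
  refine ⟨s, fun x _ => by rw [hs]; exact zeroNear_zero x, by simp, fun x hx => ?_⟩
  exact hK.zeroNear_of_isPreconnected hA (fun y hy => by
    rw [map_sub, hs]
    exact (zeroNear_zero y).sub (hc y hy)) hx₀ hsc hx

end NormedSpace

/-! ### Acyclicity of Euclidean space -/

section Euclidean

variable {N : ℕ} {K : FlasqueComplex.{0, w} (Fin N → ℝ)}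

/-- Induction on the number of nondegenerate coordinates: the slices of a box are smaller boxes or
empty. As these are connected, cocycles extend in degree 0 too, and no degree is lost. -/
theorem IsResolution.relVan_Icc (hK : K.IsResolution) (T : Finset (Fin N)) :
    ∀ (a b : Fin N → ℝ), (∀ i ∉ T, a i = b i) → ∀ q, K.RelVan q (Set.Icc a b) ∅ := by
  classical
  induction T using Finset.induction_on with
  | empty =>
    intro a b h q
    obtain rfl : a = b := funext fun i => h i (by simp)
    rw [Set.Icc_self]
    exact (hK.locEx q a).relVan isClosed_empty
  | insert i T hi ih =>
    intro a b h q
    have slice : ∀ t, (∀ q, K.RelVan q (id '' (Set.Icc a b ∩ (fun x => x i) ⁻¹' {t})) ∅) ∧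
        _root_.IsPreconnected (id '' (Set.Icc a b ∩ (fun x : Fin N → ℝ => x i) ⁻¹' {t})) := by
      intro t
      by_cases ht : a i ≤ t ∧ t ≤ b i
      · have e : id '' (Set.Icc a b ∩ (fun x => x i) ⁻¹' {t}) =
            Set.Icc (Function.update a i t) (Function.update b i t) := by
          ext x
          simp only [Set.image_id, Set.mem_inter_iff, Set.mem_Icc, Set.mem_preimage,
            Set.mem_singleton_iff, Pi.le_def]
          constructor
          · rintro ⟨⟨h1, h2⟩, h3⟩
            constructor <;> intro j <;> by_cases hj : j = i
            · subst hj; simp [h3]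
            · simp [hj, h1 j]
            · subst hj; simp [h3]
            · simp [hj, h2 j]
          · rintro ⟨h1, h2⟩
            have h3 : x i = t := le_antisymm (by simpa using h2 i) (by simpa using h1 i)
            refine ⟨⟨fun j => ?_, fun j => ?_⟩, h3⟩ <;> by_cases hj : j = i
            · subst hj; rw [h3]; exact ht.1
            · simpa [hj] using h1 j
            · subst hj; rw [h3]; exact ht.2
            · simpa [hj] using h2 j
        rw [e]
        refine ⟨ih _ _ fun j hj => ?_, (convex_Icc _ _).isPreconnected⟩
        by_cases hji : j = i
        · subst hji; simp
        · simp only [Function.update_of_ne hji]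
          exact h j (by simp [hji, hj])
      · have e : id '' (Set.Icc a b ∩ (fun x => x i) ⁻¹' {t}) = ∅ := by
          rw [Set.image_id, Set.eq_empty_iff_forall_notMem]
          rintro x ⟨⟨h1, h2⟩, h3⟩
          exact ht ⟨h3 ▸ h1 i, h3 ▸ h2 i⟩
        rw [e]
        exact ⟨fun q => relVan_empty _ _, isPreconnected_empty⟩
    rw [← Set.image_id (Set.Icc a b)]
    refine relVan_of_slices (f := fun x => x i) isCompact_Icc continuousOn_id
      Function.injective_id.injOn (by fun_prop) isClosed_empty (fun t => (slice t).1 q) fun t => ?_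
    cases q with
    | zero => exact hK.locConst.relExt_zero (slice t).2 _
    | succ q => exact ((slice t).1 q).relExt _

/-- The cohomology of the complex of sections over `V` vanishes in degree `q + 1`. -/
def VanOn {Y : Type v} [TopologicalSpace Y]
    (K : FlasqueComplex.{v, w} Y) (q : ℕ) (V : Opens Y) : Prop :=
  ∀ α : K.obj (q + 1) V, K.d (q + 1) V α = 0 → ∃ β : K.obj q V, K.d q V β = α

/-- Exhaust the space by cubes. A primitive on the next cube, corrected by a global cocycle, agrees
with the previous one on the smaller cube, so the primitives glue. -/
theorem IsResolution.vanOn_pi (hK : K.IsResolution) (q : ℕ) : K.VanOn q ⊤ := by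
  intro α hα
  let I : ℕ → Set (Fin N → ℝ) := fun n => Set.Icc (fun _ => -(n : ℝ)) (fun _ => n)
  have hI : Monotone I := fun m n h => by
    have : (m : ℝ) ≤ n := by exact_mod_cast h
    exact Set.Icc_subset_Icc (fun _ => neg_le_neg this) (fun _ => this)
  have hex : ∀ x, ∃ n, x ∈ interior (I n) := by
    intro x
    obtain ⟨n, hn⟩ := exists_nat_gt ‖x‖
    refine ⟨n, mem_interior.2 ⟨Metric.ball 0 n, ?_, Metric.isOpen_ball, by simpa using hn⟩⟩
    intro y hy
    rw [mem_ball_zero_iff] at hy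
    exact ⟨fun i => (abs_le.1 ((norm_le_pi_norm y i).trans hy.le)).1,
      fun i => (abs_le.1 ((norm_le_pi_norm y i).trans hy.le)).2⟩
  have van : ∀ n q, K.RelVan q (I n) ∅ := fun n q =>
    hK.relVan_Icc Finset.univ _ _ (by simp) q
  have ext : ∀ n, K.RelExt q (I n) Set.univ ∅ := fun n => by
    cases q with
    | zero => exact hK.locConst.relExt_zero (convex_Icc _ _).isPreconnected _
    | succ q => exact (van n q).relExt _
  have step : ∀ n (b : K.obj q ⊤), (∀ x ∈ I n, K.ZeroNear (K.d q ⊤ b - α) x) →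
      ∃ b' : K.obj q ⊤, (∀ x ∈ I (n + 1), K.ZeroNear (K.d q ⊤ b' - α) x) ∧
        ∀ x ∈ I n, K.ZeroNear (b' - b) x := by
    intro n b hb
    obtain ⟨b₁, -, hb₁⟩ := van (n + 1) q α (fun x _ => by rw [hα]; exact zeroNear_zero x) (by simp)
    obtain ⟨c, hc, -, hc'⟩ := ext n (b₁ - b) (fun x hx => by
      have := (hb₁ x (hI n.le_succ hx)).sub (hb x hx)
      rwa [sub_sub_sub_cancel_right, ← map_sub] at this) (by simp)
    refine ⟨b₁ - c, fun x hx => ?_, fun x hx => ?_⟩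
    · have := (hb₁ x hx).sub (hc x trivial)
      rwa [map_sub, sub_right_comm]
    · have := (hc' x hx).neg
      rwa [neg_sub, sub_right_comm] at this
  obtain ⟨b₀, -, hb₀⟩ := van 0 q α (fun x _ => by rw [hα]; exact zeroNear_zero x) (by simp)
  let σ : (n : ℕ) → {b : K.obj q ⊤ // ∀ x ∈ I n, K.ZeroNear (K.d q ⊤ b - α) x} := fun n =>
    Nat.rec ⟨b₀, hb₀⟩ (fun n b => ⟨(step n b.1 b.2).choose, (step n b.1 b.2).choose_spec.1⟩) n
  have hσ : ∀ n, ∀ x ∈ I n, K.ZeroNear ((σ (n + 1)).1 - (σ n).1) x := fun n =>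
    (step n (σ n).1 (σ n).2).choose_spec.2
  have hσ' : ∀ m n, m ≤ n → ∀ x ∈ I m, K.ZeroNear ((σ n).1 - (σ m).1) x := by
    intro m n h
    induction n, h using Nat.le_induction with
    | base => intro x _; rw [sub_self]; exact zeroNear_zero x
    | succ n h ih =>
      intro x hx
      simpa using (hσ n x (hI h hx)).add (ih x hx)
  obtain ⟨b, hb⟩ := K.glue (ι := ULift.{w} ℕ) (fun n => ⟨interior (I n.down), isOpen_interior⟩) ⊤
    (fun _ => le_top) (fun x _ => (hex x).elim fun n hn => ⟨⟨n⟩, hn⟩)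
    (fun n => K.res q le_top (σ n.down).1) (fun m n => by
      rw [K.res_res, K.res_res, ← sub_eq_zero, ← map_sub]
      refine res_eq_zero_of_zeroNear fun x hx => ?_
      rcases le_total m.down n.down with h | h
      · rw [← neg_sub]
        exact (hσ' _ _ h x (interior_subset hx.1)).neg
      · exact hσ' _ _ h x (interior_subset hx.2))
  refine ⟨b, sub_eq_zero.1 (eq_zero_of_zeroNear fun x => ?_)⟩
  obtain ⟨n, hn⟩ := hex x
  have h1 : K.ZeroNear (b - (σ n).1) x :=
    ⟨⟨interior (I n), isOpen_interior⟩, hn, by rw [map_sub, hb ⟨n⟩, sub_self]⟩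
  have := h1.d.add ((σ n).2 x (interior_subset hn))
  rwa [map_sub, sub_add_sub_cancel] at this

end Euclidean

theorem VanOn.of_eq {Y : Type v} [TopologicalSpace Y] {K : FlasqueComplex.{v, w} Y} {q : ℕ}
    {V W : Opens Y} (h : K.VanOn q V) (e : V = W) : K.VanOn q W := e ▸ h

theorem IsResolution.vanOn_of_homeomorph {Y : Type v} [TopologicalSpace Y]
    {K : FlasqueComplex.{v, w} Y} (hK : K.IsResolution) {P : Type*} [NormedAddCommGroup P]
    [NormedSpace ℝ P] [FiniteDimensional ℝ P] {φ : P → Y} (hφ : IsOpenEmbedding φ) (q : ℕ)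
    {V : Opens Y} (hV : (V : Set Y) = Set.range φ) : K.VanOn q V := by
  let e := (Module.finBasis ℝ P).equivFunL.symm.toHomeomorph
  have h := (hK.pullback (hφ.comp e.isOpenEmbedding)).vanOn_pi q
  refine VanOn.of_eq (K := K) (V := imageOpens (hφ.comp e.isOpenEmbedding) ⊤) h (Opens.ext ?_)
  rw [hV]
  change φ ∘ e '' Set.univ = _
  rw [Set.image_univ, Set.range_comp, e.surjective.range_eq, Set.image_univ]

end FlasqueComplex

/-! ### Topology of open cones -/

namespace OpenCone

variable {L : Type u}

/-- The radius `[y, t] ↦ t`. -/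
def radius : OpenCone L → ℝ :=
  Quotient.lift (Sum.elim (fun z => (z.2 : ℝ)) fun _ => 0) (by
    rintro a b (rfl | ⟨h, h'⟩)
    · rfl
    · exact h.trans h'.symm)

@[simp] theorem radius_mk (y : L) (t : Set.Ico (0 : ℝ) 1) : radius (mk y t) = t := rfl

@[simp] theorem radius_apex : radius (apex L) = 0 := rfl

theorem eq_apex_or_mk (c : OpenCone L) : c = apex L ∨ ∃ y t, c = mk y t := by
  obtain ⟨z | z⟩ := c
  · exact Or.inr ⟨z.1, z.2, rfl⟩
  · exact Or.inl rfl

theorem eq_apex_of_radius {c : OpenCone L} (h : radius c = 0) : c = apex L := by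
  obtain ⟨z | z⟩ := c
  · exact Quotient.sound (Or.inr ⟨h, rfl⟩)
  · rfl

theorem mk_eq_mk_iff {y y' : L} {t t' : Set.Ico (0 : ℝ) 1} (ht : (0 : ℝ) < t) :
    mk y t = mk y' t' ↔ y = y' ∧ t = t' := by
  constructor
  · intro h
    rcases Quotient.exact h with h | h
    · rw [Sum.inl.injEq, Prod.mk.injEq] at h
      exact h
    · exact (ht.ne' h.1).elim
  · rintro ⟨rfl, rfl⟩
    rfl

theorem radius_nonneg (c : OpenCone L) : 0 ≤ radius c := by
  rcases eq_apex_or_mk c with rfl | ⟨y, t, rfl⟩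
  · simp
  · exact t.2.1

variable [TopologicalSpace L]

theorem continuous_radius : Continuous (radius (L := L)) :=
  Continuous.quotient_lift (continuous_sum_dom.2
    ⟨continuous_subtype_val.comp continuous_snd, continuous_const⟩) _

theorem continuous_mk : Continuous fun z : L × Set.Ico (0 : ℝ) 1 => mk z.1 z.2 :=
  continuous_quotient_mk'.comp continuous_inl

theorem isCompact_radius_le [CompactSpace L] {r : ℝ} (h1 : r < 1) :
    IsCompact {c : OpenCone L | radius c ≤ r} := by
  have hI : IsCompact {t : Set.Ico (0 : ℝ) 1 | (t : ℝ) ≤ r} := by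
    rw [Subtype.isCompact_iff]
    convert isCompact_Icc (a := (0 : ℝ)) (b := r) using 1
    ext t
    constructor
    · rintro ⟨t, ht, rfl⟩
      exact ⟨t.2.1, ht⟩
    · rintro ⟨h, h'⟩
      exact ⟨⟨t, h, h'.trans_lt h1⟩, h', rfl⟩
  have hc : IsCompact ((fun z : L × Set.Ico (0 : ℝ) 1 => mk z.1 z.2) ''
      (Set.univ ×ˢ {t : Set.Ico (0 : ℝ) 1 | (t : ℝ) ≤ r}) ∪ {apex L}) :=
    ((isCompact_univ.prod hI).image continuous_mk).union (isCompact_singleton (x := apex L))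
  refine hc.of_isClosed_subset (isClosed_le continuous_radius continuous_const) ?_
  intro c hc
  rcases eq_apex_or_mk c with rfl | ⟨y, t, rfl⟩
  · exact Or.inr rfl
  · exact Or.inl ⟨(y, t), ⟨trivial, hc⟩, rfl⟩

/-- Tube lemma for `L × {0}`; compactness of the link is essential. -/
theorem exists_radius_lt_subset [CompactSpace L] {V : Set (OpenCone L)} (hV : V ∈ 𝓝 (apex L)) :
    ∃ ε, 0 < ε ∧ ε < 1 ∧ {c : OpenCone L | radius c < ε} ⊆ V := by
  obtain ⟨V', hVV, hV', hV0⟩ := mem_nhds_iff.1 hV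
  let zero : Set.Ico (0 : ℝ) 1 := ⟨0, by simp⟩
  obtain ⟨u, v, -, hv, hu, hv0, huv⟩ := generalized_tube_lemma (isCompact_univ (X := L))
    (isCompact_singleton (x := zero)) (hV'.preimage continuous_mk) (by
      rintro ⟨y, t⟩ ⟨-, rfl⟩
      have : mk y zero = apex L := eq_apex_of_radius rfl
      change mk y zero ∈ V'
      rwa [this])
  obtain ⟨ε, hε, hball⟩ := Metric.isOpen_iff.1 hv zero (hv0 rfl)
  refine ⟨min ε (1 / 2), by positivity, (min_le_right _ _).trans_lt (by norm_num), ?_⟩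
  intro c hc
  rcases eq_apex_or_mk c with rfl | ⟨y, t, rfl⟩
  · exact hVV hV0
  · refine hVV (huv ⟨hu trivial, hball ?_⟩ : (y, t) ∈ _)
    rw [Metric.mem_ball, Subtype.dist_eq, Real.dist_eq]
    simp only [Set.mem_ofPred_eq, radius_mk] at hc
    rw [show ((zero : Set.Ico (0 : ℝ) 1) : ℝ) = 0 from rfl, sub_zero, abs_of_nonneg t.2.1]
    exact hc.trans_le (min_le_left _ _)

theorem isOpenEmbedding_mk :
    IsOpenEmbedding fun z : L × Set.Ioo (0 : ℝ) 1 =>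
      mk z.1 (Set.inclusion Set.Ioo_subset_Ico_self z.2) := by
  have hι : IsOpenEmbedding (Prod.map id (Set.inclusion Set.Ioo_subset_Ico_self) :
      L × Set.Ioo (0 : ℝ) 1 → L × Set.Ico (0 : ℝ) 1) :=
    IsOpenEmbedding.id.prodMap (.inclusion _ (isOpen_Ioo.preimage continuous_subtype_val))
  refine .of_continuous_injective_isOpenMap (continuous_mk.comp hι.continuous) ?_ ?_
  · rintro ⟨y, t⟩ ⟨y', t'⟩ h
    obtain ⟨rfl, h⟩ := (mk_eq_mk_iff t.2.1).1 h
    exact Prod.ext rfl (Set.inclusion_injective Set.Ioo_subset_Ico_self h)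
  · intro U hU
    refine isOpen_coinduced.2 (isOpen_sum_iff.2 ⟨?_, ?_⟩)
    · convert hι.isOpenMap _ hU using 1
      ext ⟨y, t⟩
      constructor
      · rintro ⟨⟨y', t'⟩, h, e⟩
        obtain ⟨rfl, rfl⟩ := (mk_eq_mk_iff t'.2.1).1 e
        exact ⟨_, h, rfl⟩
      · rintro ⟨⟨y', t'⟩, h, e⟩
        cases e
        exact ⟨_, h, rfl⟩
    · convert isOpen_empty using 1
      rw [Set.eq_empty_iff_forall_notMem]
      rintro a ⟨⟨y', t'⟩, h, e⟩
      have := congrArg radius e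
      exact t'.2.1.ne' this

end OpenCone

/-! ### Strata and cone points in distinguished charts -/

open OpenCone

theorem apex_mem_coneFiltration {L : Type u} [TopologicalSpace L] {G : ℤ → Set L} {i : ℤ}
    (h : 0 ≤ i) : apex L ∈ coneFiltration G i := Or.inl ⟨h, rfl⟩

theorem mk_mem_coneFiltration {L : Type u} [TopologicalSpace L] {G : ℤ → Set L} {i : ℤ} {y : L}
    {t : Set.Ico (0 : ℝ) 1} (ht : (0 : ℝ) < t) : mk y t ∈ coneFiltration G i ↔ y ∈ G (i - 1) := by
  constructor
  · rintro (⟨-, h⟩ | ⟨y', hy', t', h⟩)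
    · exact (ht.ne' (congrArg radius h)).elim
    · rwa [((mk_eq_mk_iff ht).1 h).1]
  · exact fun h => Or.inr ⟨y, h, t, rfl⟩

namespace IsTopologicalStratification

variable {n : ℤ} {X : Type u} [TopologicalSpace X] {F : ℤ → Set X}

theorem isClosedFiltration (h : IsTopologicalStratification n X F) : IsClosedFiltration n F := by
  rw [IsTopologicalStratification] at h
  exact h.2.2.1

theorem exists_chart (h : IsTopologicalStratification n X F) (d k : ℕ) (hd : (d : ℤ) + k = n)
    {x : X} (hx : x ∈ F d \ F (d - 1)) :
    ∃ (L : Type u) (_ : TopologicalSpace L) (G : ℤ → Set L),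
      CompactSpace L ∧ T2Space L ∧ IsTopologicalStratification (k - 1) L G ∧
        ∃ φ : EuclideanSpace ℝ (Fin d) × OpenCone L → X, IsDistinguishedChart F x d G φ := by
  rw [IsTopologicalStratification] at h
  exact h.2.2.2.2 d k hd x hx

end IsTopologicalStratification

namespace IsClosedFiltration

variable {X : Type u} [TopologicalSpace X] {F : ℤ → Set X}

theorem eq_empty {n : ℤ} (h : IsClosedFiltration n F) {i : ℤ} (hi : i ≤ -1) : F i = ∅ :=
  Set.subset_empty_iff.1 ((h.mono hi).trans h.bot.subset)

theorem exists_mem_stratum {n : ℕ} (h : IsClosedFiltration n F) (x : X) :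
    ∃ d k : ℕ, (d : ℤ) + k = n ∧ x ∈ F d \ F (d - 1) := by
  classical
  have hex : ∃ d : ℕ, x ∈ F d := ⟨n, by rw [h.top]; trivial⟩
  have hle : Nat.find hex ≤ n := Nat.find_le (by rw [h.top]; trivial)
  refine ⟨Nat.find hex, n - Nat.find hex, by omega, Nat.find_spec hex, fun hx => ?_⟩
  rcases Nat.eq_zero_or_pos (Nat.find hex) with h0 | h0
  · rw [h0, h.eq_empty (by simp)] at hx
    exact hx
  · refine Nat.find_min hex (Nat.sub_one_lt h0.ne') ?_
    convert hx using 2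
    omega

end IsClosedFiltration

namespace IsDistinguishedChart

variable {X : Type u} [TopologicalSpace X] {F : ℤ → Set X} {x : X} {d : ℕ}
  {L : Type u} [TopologicalSpace L] {G : ℤ → Set L}
  {φ : EuclideanSpace ℝ (Fin d) × OpenCone L → X}

theorem apply_mem_iff (h : IsDistinguishedChart F x d G φ) (z) (i : ℤ) :
    φ z ∈ F i ↔ z.2 ∈ coneFiltration G (i - d) := by
  change z ∈ φ ⁻¹' F i ↔ _
  simp [h.preimage]

/-- In the chart `F d` corresponds to index `0` of the cone filtration. That set involves `G (-1) =
∅`, so it contains only the apex. -/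
theorem exists_eq_apex (h : IsDistinguishedChart F x d G φ) {k : ℤ}
    (hG : IsClosedFiltration k G) (hx : x ∈ F d) : ∃ a, φ (a, apex L) = x := by
  obtain ⟨⟨a, c⟩, rfl⟩ := h.mem_range
  rw [h.apply_mem_iff, sub_self] at hx
  rcases hx with ⟨-, e⟩ | ⟨y, hy, -⟩
  · rw [← e]
    exact ⟨a, rfl⟩
  · rw [hG.eq_empty (by simp)] at hy
    exact hy.elim

theorem apex_mem_stratum (h : IsDistinguishedChart F x d G φ) {k : ℤ}
    (hG : IsClosedFiltration k G) (a) : φ (a, apex L) ∈ F d \ F (d - 1) := by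
  constructor
  · rw [h.apply_mem_iff]
    exact apex_mem_coneFiltration (by simp)
  · rw [h.apply_mem_iff]
    rintro (⟨h, -⟩ | ⟨y, hy, -⟩)
    · omega
    · rw [hG.eq_empty (by omega)] at hy
      exact hy.elim

end IsDistinguishedChart

/-! ### From local to global vanishing on compact stratified spaces -/

namespace FlasqueComplex

/-- Local vanishing above the codimension along a compact stratified space implies
global vanishing above the dimension. -/
theorem vanAbove_of_stratification {Y : Type v} [TopologicalSpace Y] [NormalSpace Y] [T2Space Y]
    (K : FlasqueComplex.{v, w} Y) (m : ℕ) :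
    ∀ {L : Type u} [TopologicalSpace L] [CompactSpace L] [T2Space L] {F : ℤ → Set L},
      IsTopologicalStratification m L F → ∀ {ψ : L → Y}, Continuous ψ → Function.Injective ψ →
      (∀ d k : ℕ, (d : ℤ) + k = m → ∀ y ∈ F d \ F (d - 1), ∀ q, k - 1 ≤ q → K.LocEx q (ψ y)) →
      K.VanAbove m (Set.range ψ) := by
  induction m using Nat.strong_induction_on with
  | _ m IH =>
  intro L _ _ _ F hF ψ hψ hψ' hloc
  suffices hB : ∀ x : L, ∃ B ∈ 𝓝 x, IsClosed B ∧ K.VanAbove m (ψ '' B) by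
    choose B hB cB vB using hB
    obtain ⟨t, -, ht⟩ := isCompact_univ.elim_nhds_subcover B fun x _ => hB x
    have e : Set.range ψ = ⋃ x ∈ t, ψ '' B x := by
      rw [← Set.image_univ, ← Set.image_iUnion₂, Set.univ_subset_iff.1 ht]
    rw [e]
    exact VanAbove.biUnion t (fun x _ => ((cB x).isCompact.image hψ).isClosed) fun x _ => vB x
  intro x
  obtain ⟨d, k, hdk, hx⟩ := hF.isClosedFiltration.exists_mem_stratum x
  obtain ⟨L', _, G, _, _, hG, φ, hφ⟩ := hF.exists_chart d k hdk hx
  obtain ⟨a, rfl⟩ := hφ.exists_eq_apex hG.isClosedFiltration hx.1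
  have hφc := hφ.isOpenEmbedding.continuous
  have hinj := hφ.isOpenEmbedding.injective
  -- Any radius bound strictly between 0 and 1 would do: the box is then compact, and a
  -- neighbourhood of `(a, apex)` for suitable `lo`, `hi`.
  let box (lo hi : Fin d → ℝ) : Set (EuclideanSpace ℝ (Fin d) × OpenCone L') :=
    {z | (∀ i, z.1 i ∈ Set.Icc (lo i) (hi i)) ∧ radius z.2 ≤ 1 / 2}
  have cbox : ∀ lo hi, IsCompact (box lo hi) := by
    intro lo hi
    have h1 : IsCompact ((EuclideanSpace.equiv (Fin d) ℝ).toHomeomorph ⁻¹' Set.Icc lo hi) :=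
      (Homeomorph.isCompact_preimage _).2 isCompact_Icc
    convert h1.prod (isCompact_radius_le (L := L') (r := 1 / 2) (by norm_num)) using 1
    ext z
    simp only [box, Set.mem_ofPred_eq, Set.mem_prod, Set.mem_preimage, Set.mem_Icc, Pi.le_def,
      ← forall_and]
    rfl
  have hg : Continuous (ψ ∘ φ) := hψ.comp hφc
  have hg' : Function.Injective (ψ ∘ φ) := hψ'.comp hinj
  -- The subtraction is truncated: for `k = 0` the bound is `0`, not `-1`.
  have vapex : ∀ v, K.VanAbove (k - 1) {ψ (φ (v, apex L'))} := fun v =>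
    vanAbove_singleton (hloc d k hdk _ (hφ.apex_mem_stratum hG.isClosedFiltration v))
  have base : ∀ lo, K.VanAbove k ((ψ ∘ φ) '' box lo lo) := by
    intro lo
    let v₀ := (EuclideanSpace.equiv (Fin d) ℝ).symm lo
    have hv₀ : ∀ z ∈ box lo lo, z.1 = v₀ := by
      rintro z ⟨hz, -⟩
      ext i
      exact le_antisymm (hz i).2 (hz i).1
    rcases Nat.eq_zero_or_pos k with rfl | hk
    · have hG' := hG.isClosedFiltration
      have : IsEmpty L' := by
        rw [← Set.univ_eq_empty_iff, ← hG'.top, hG'.eq_empty (by simp)]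
      have e : (ψ ∘ φ) '' box lo lo ⊆ {ψ (φ (v₀, apex L'))} := by
        rintro _ ⟨⟨v, c⟩, hz, rfl⟩
        have h1 : v = v₀ := hv₀ _ hz
        rcases eq_apex_or_mk c with rfl | ⟨y, -⟩
        · rw [h1]; rfl
        · exact isEmptyElim y
      rcases Set.subset_singleton_iff_eq.1 e with e | e <;> rw [e]
      · exact vanAbove_empty _
      · exact vapex v₀
    · obtain ⟨e, rfl⟩ : ∃ e, k = e + 1 := ⟨k - 1, by omega⟩
      refine vanAbove_of_slices (cbox lo lo) hg.continuousOn hg'.injOn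
        (f := fun z => radius z.2) (continuous_radius.comp continuous_snd).continuousOn fun t => ?_
      rcases lt_trichotomy t 0 with ht | rfl | ht
      · convert vanAbove_empty e
        rw [Set.image_eq_empty, Set.eq_empty_iff_forall_notMem]
        rintro z ⟨-, rfl⟩
        exact absurd (radius_nonneg z.2) (not_le.2 ht)
      · have h : (ψ ∘ φ) '' (box lo lo ∩ (fun z => radius z.2) ⁻¹' {0}) ⊆
            {ψ (φ (v₀, apex L'))} := by
          rintro _ ⟨⟨v, c⟩, ⟨hz, hz'⟩, rfl⟩
          have h1 : v = v₀ := hv₀ _ hz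
          have h2 : c = apex L' := eq_apex_of_radius hz'
          rw [h1, h2]; rfl
        rcases Set.subset_singleton_iff_eq.1 h with h | h <;> rw [h]
        · exact vanAbove_empty _
        · exact vapex v₀
      · by_cases ht' : t ≤ 1 / 2
        · let t' : Set.Ico (0 : ℝ) 1 := ⟨t, ht.le, ht'.trans_lt (by norm_num)⟩
          have e1 : (ψ ∘ φ) '' (box lo lo ∩ (fun z => radius z.2) ⁻¹' {t}) =
              Set.range fun y => ψ (φ (v₀, OpenCone.mk y t')) := by
            ext p
            constructor
            · rintro ⟨⟨v, c⟩, ⟨hz, hz'⟩, rfl⟩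
              have h1 : v = v₀ := hv₀ _ hz
              have h2 : radius c = t := hz'
              rcases eq_apex_or_mk c with rfl | ⟨y, s, rfl⟩
              · exact absurd h2 ht.ne
              · obtain rfl : s = t' := Subtype.ext h2
                exact ⟨y, by rw [h1]; rfl⟩
            · rintro ⟨y, rfl⟩
              exact ⟨(v₀, OpenCone.mk y t'), ⟨⟨fun i => ⟨le_rfl, le_rfl⟩, ht'⟩, rfl⟩, rfl⟩
          rw [e1]
          have hG1 : IsTopologicalStratification (e : ℤ) L' G := by
            have := hG
            rwa [show ((e + 1 : ℕ) : ℤ) - 1 = e by push_cast; ring] at this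
          -- A slice of positive radius is a copy of the link. Its points have the same codimension
          -- in the link as in `L`, all dimensions being shifted by `d + 1`, so the local bounds are
          -- inherited.
          refine IH e (by omega) hG1 (ψ := fun y => ψ (φ (v₀, OpenCone.mk y t'))) ?_ ?_ ?_
          · exact hg.comp (continuous_const.prodMk
              (continuous_mk.comp (continuous_id.prodMk continuous_const)))
          · intro y y' h
            have := hg' h
            rw [Prod.mk.injEq] at this
            exact ((mk_eq_mk_iff ht).1 this.2).1
          · intro j k' hjk y hy q hq
            refine hloc (d + j + 1) k' (by push_cast at hdk ⊢; omega) _ ⟨?_, ?_⟩ q hq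
            · rw [hφ.apply_mem_iff, mk_mem_coneFiltration ht]
              convert hy.1 using 2
              push_cast; ring
            · rw [hφ.apply_mem_iff, mk_mem_coneFiltration ht]
              convert hy.2 using 3
              push_cast; ring
        · convert vanAbove_empty e
          rw [Set.image_eq_empty, Set.eq_empty_iff_forall_notMem]
          rintro z ⟨hz, rfl⟩
          exact ht' hz.2
  -- Coordinates outside `T` are frozen, and each swept coordinate raises the bound by one. Sweeping
  -- all of them gives `k + d = m`.
  have vbox : ∀ (T : Finset (Fin d)) (lo hi : Fin d → ℝ), (∀ i ∉ T, lo i = hi i) →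
      K.VanAbove (k + T.card) ((ψ ∘ φ) '' box lo hi) := by
    intro T
    induction T using Finset.induction_on with
    | empty =>
      intro lo hi h
      obtain rfl : lo = hi := funext fun i => h i (by simp)
      exact base lo
    | insert i T hi ih =>
      intro a b h
      rw [Finset.card_insert_of_notMem hi, ← add_assoc]
      refine vanAbove_of_slices (cbox a b) hg.continuousOn hg'.injOn (f := fun z => z.1 i)
        (by fun_prop) fun t => ?_
      by_cases ht : a i ≤ t ∧ t ≤ b i
      · have e : box a b ∩ (fun z => z.1 i) ⁻¹' {t} =
            box (Function.update a i t) (Function.update b i t) := by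
          ext z
          simp only [box, Set.mem_inter_iff, Set.mem_ofPred_eq, Set.mem_preimage,
            Set.mem_singleton_iff]
          constructor
          · rintro ⟨⟨h1, h2⟩, h3⟩
            refine ⟨fun j => ?_, h2⟩
            by_cases hj : j = i
            · subst hj; simp [h3]
            · simpa [hj] using h1 j
          · rintro ⟨h1, h2⟩
            have h3 : z.1 i = t := by simpa using h1 i
            refine ⟨⟨fun j => ?_, h2⟩, h3⟩
            by_cases hj : j = i
            · subst hj; rw [h3]; exact ht
            · simpa [hj] using h1 j
        rw [e]
        refine ih _ _ fun j hj => ?_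
        by_cases hji : j = i
        · subst hji; simp
        · simp only [Function.update_of_ne hji]
          exact h j (by simp [hji, hj])
      · convert vanAbove_empty _
        rw [Set.image_eq_empty, Set.eq_empty_iff_forall_notMem]
        rintro z ⟨⟨h1, -⟩, h3⟩
        exact ht (h3 ▸ h1 i)
  have hfin := vbox Finset.univ (fun i => a i - 1) (fun i => a i + 1) (by simp)
  rw [Finset.card_univ, Fintype.card_fin, show k + d = m by omega, Set.image_comp] at hfin
  refine ⟨_, ?_, ((cbox _ _).image hφc).isClosed, hfin⟩
  refine hφ.isOpenEmbedding.isOpenMap.image_mem_nhds ?_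
  have h1 : ∀ᶠ z : EuclideanSpace ℝ (Fin d) × OpenCone L' in 𝓝 (a, apex L'),
      ∀ i, z.1 i ∈ Set.Icc (a i - 1) (a i + 1) := by
    refine Filter.eventually_all.2 fun i => ?_
    have hc : Continuous fun z : EuclideanSpace ℝ (Fin d) × OpenCone L' => z.1 i := by fun_prop
    exact hc.continuousAt.eventually_mem (Icc_mem_nhds (by simp) (by simp))
  have h2 : ∀ᶠ z : EuclideanSpace ℝ (Fin d) × OpenCone L' in 𝓝 (a, apex L'),
      radius z.2 < 1 / 2 :=
    (continuous_radius.comp continuous_snd).continuousAt.eventually_lt continuousAt_const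
      (by simp)
  filter_upwards [h1, h2] with z hz hz'
  exact ⟨hz, hz'.le⟩

end FlasqueComplex

/-! ### Cohomology of the regular parts of links -/

open OpenCone

/-- The projection of `P × (X - X^(n-1))` to `X`. -/
def regularProj (P : Type) [TopologicalSpace P] {X : Type u} [TopologicalSpace X] (A : Set X) :
    C(P × ↥Aᶜ, X) := ⟨fun z => z.2.1, by fun_prop⟩

/-- The products of the regular part of a compact stratified space of dimension `e` with
Euclidean spaces have no cohomology with locally constant coefficients in degrees `> e`. -/
def LinkVanishing (e : ℕ) : Prop :=
  ∀ {L : Type u} [TopologicalSpace L] [CompactSpace L] [T2Space L] {F : ℤ → Set L},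
    IsTopologicalStratification e L F →
    ∀ {P : Type} [NormedAddCommGroup P] [NormedSpace ℝ P] [FiniteDimensional ℝ P]
      {Y : Type u} [TopologicalSpace Y] {K : FlasqueComplex.{u, w} Y}, K.IsResolution →
      ∀ {θ : P × ↥(F ((e : ℤ) - 1))ᶜ → Y}, IsOpenEmbedding θ → ∀ q, e ≤ q →
        ∀ V : Opens Y, (V : Set Y) = Set.range θ → K.VanOn q V

theorem isOpenEmbedding_univBall {E : Type*} [NormedAddCommGroup E] [NormedSpace ℝ E] (a : E)
    (r : ℝ) : IsOpenEmbedding (OpenPartialHomeomorph.univBall a r) :=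
  OpenPartialHomeomorph.isOpenEmbedding _ (OpenPartialHomeomorph.univBall_source _ _)

theorem range_univBall {E : Type*} [NormedAddCommGroup E] [NormedSpace ℝ E] (a : E)
    {r : ℝ} (hr : 0 < r) : Set.range (OpenPartialHomeomorph.univBall a r) = Metric.ball a r := by
  rw [← OpenPartialHomeomorph.univBall_target a hr, ← OpenPartialHomeomorph.image_source_eq_target,
    OpenPartialHomeomorph.univBall_source, Set.image_univ]

theorem exists_isOpenEmbedding_Ioo {ε : ℝ} (h0 : 0 < ε) (h1 : ε < 1) :
    ∃ τ : ℝ → Set.Ioo (0 : ℝ) 1, IsOpenEmbedding τ ∧ ∀ t, t ∈ Set.range τ ↔ (t : ℝ) < ε := by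
  have hr := range_univBall (ε / 2) (half_pos h0)
  have hmem : ∀ s, OpenPartialHomeomorph.univBall (ε / 2) (ε / 2) s ∈ Set.Ioo 0 ε := fun s => by
    have : OpenPartialHomeomorph.univBall (ε / 2) (ε / 2) s ∈ Metric.ball (ε / 2) (ε / 2) :=
      hr ▸ Set.mem_range_self s
    rw [Real.ball_eq_Ioo] at this
    exact ⟨by linarith [this.1], by linarith [this.2]⟩
  refine ⟨fun s => ⟨_, (hmem s).1, (hmem s).2.trans h1⟩,
    .of_comp _ isOpen_Ioo.isOpenEmbedding_subtypeVal (isOpenEmbedding_univBall _ _), fun t => ?_⟩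
  constructor
  · rintro ⟨s, rfl⟩
    exact (hmem s).2
  · intro ht
    have : (t : ℝ) ∈ Set.range (OpenPartialHomeomorph.univBall (ε / 2) (ε / 2)) := by
      rw [hr, Real.ball_eq_Ioo]
      exact ⟨by linarith [t.2.1], by linarith⟩
    obtain ⟨s, hs⟩ := this
    exact ⟨s, Subtype.ext hs⟩

namespace FlasqueComplex

theorem VanOn.locEx {Y : Type v} [TopologicalSpace Y] {K : FlasqueComplex.{v, w} Y} {q : ℕ}
    {x : Y} (h : ∀ V : Opens Y, x ∈ V → ∃ N ≤ V, x ∈ N ∧ K.VanOn q N) : K.LocEx q x := by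
  intro V hx α hα
  obtain ⟨N, hNV, hxN, hN⟩ := h V hx
  obtain ⟨β, hβ⟩ := hN (K.res _ hNV α) (by rw [K.d_res, hα, map_zero])
  exact ⟨N, hNV, hxN, β, hβ⟩

/-- The direct image to `X` of a resolution of a locally constant sheaf on `P × (X - X^(n-1))` has
no cohomology in degrees `≥ max(k, 1)` at a point of codimension `k`. -/
theorem locEx_of_linkVanishing {n : ℕ} {X : Type u} [TopologicalSpace X] {F : ℤ → Set X}
    (hF : IsTopologicalStratification n X F) {P : Type} [NormedAddCommGroup P] [NormedSpace ℝ P]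
    [FiniteDimensional ℝ P] {K : FlasqueComplex.{u, w} (P × ↥(F ((n : ℤ) - 1))ᶜ)}
    (hK : K.IsResolution) {d k : ℕ} (hdk : (d : ℤ) + k = n)
    (hS : ∀ e, e + 1 = k → LinkVanishing.{u, w} e) {x : X} (hx : x ∈ F d \ F (d - 1)) {q : ℕ}
    (hq : k - 1 ≤ q) : (K.pushforward (regularProj P (F ((n : ℤ) - 1)))).LocEx q x := by
  obtain ⟨L, _, G, _, _, hG, φ, hφ⟩ := hF.exists_chart d k hdk hx
  have hG' := hG.isClosedFiltration
  obtain ⟨a, rfl⟩ := hφ.exists_eq_apex hG' hx.1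
  have hφo := hφ.isOpenEmbedding
  have hreg : IsOpenEmbedding (Subtype.val : ↥(F ((n : ℤ) - 1))ᶜ → X) :=
    (hF.isClosedFiltration.isClosed _).isOpen_compl.isOpenEmbedding_subtypeVal
  refine VanOn.locEx fun V hV => ?_
  obtain ⟨A, hA, C, hC, hAC⟩ := mem_nhds_prod_iff.1
    ((V.2.preimage hφo.continuous).mem_nhds (hV : φ (a, apex L) ∈ V))
  obtain ⟨r, hr, hrA⟩ := Metric.mem_nhds_iff.1 hA
  obtain ⟨ε, hε, hε1, hεC⟩ := exists_radius_lt_subset hC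
  let B : Set (EuclideanSpace ℝ (Fin d) × OpenCone L) := Metric.ball a r ×ˢ {c | radius c < ε}
  have hB : IsOpen B :=
    Metric.isOpen_ball.prod (isOpen_lt continuous_radius continuous_const)
  refine ⟨⟨φ '' B, hφo.isOpenMap _ hB⟩, ?_, ⟨(a, apex L), ⟨Metric.mem_ball_self hr, hε⟩, rfl⟩, ?_⟩
  · rintro _ ⟨z, hz, rfl⟩
    exact hAC ⟨hrA hz.1, hεC hz.2⟩
  change K.VanOn q _
  let u := OpenPartialHomeomorph.univBall a r
  have hu : IsOpenEmbedding u := isOpenEmbedding_univBall a r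
  have hur : Set.range u = Metric.ball a r := range_univBall a hr
  rcases k with _ | e
  -- In codimension 0 the link is empty and the cone is a point, so the preimage of the
  -- neighbourhood is `P × ℝ^d` and acyclicity of Euclidean space applies.
  · have : IsEmpty L := by
      rw [← Set.univ_eq_empty_iff, ← hG'.top, hG'.eq_empty (by simp)]
    have hapex : ∀ c : OpenCone L, c = apex L := fun c => by
      rcases eq_apex_or_mk c with h | ⟨y, -⟩
      · exact h
      · exact isEmptyElim y
    have hmem : ∀ v, φ (v, apex L) ∈ (F ((n : ℤ) - 1))ᶜ := fun v => by
      have := (hφ.apex_mem_stratum hG' v).2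
      rwa [show (d : ℤ) = n by simpa using hdk] at this
    have hι : IsOpenEmbedding fun v : EuclideanSpace ℝ (Fin d) => (v, apex L) := by
      refine .of_continuous_injective_isOpenMap (by fun_prop)
        (fun v v' h => (Prod.mk.inj h).1) fun U hU => ?_
      convert hU.preimage (continuous_fst (X := EuclideanSpace ℝ (Fin d)) (Y := OpenCone L))
      ext ⟨v, c⟩
      constructor
      · rintro ⟨v, hv, e⟩
        cases e
        exact hv
      · exact fun hv => ⟨v, hv, by rw [hapex c]⟩
    let κ : EuclideanSpace ℝ (Fin d) → ↥(F ((n : ℤ) - 1))ᶜ := fun v => ⟨φ (u v, apex L), hmem _⟩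
    have hκ : IsOpenEmbedding κ := .of_comp _ hreg (hφo.comp (hι.comp hu))
    refine hK.vanOn_of_homeomorph (φ := Prod.map id κ) (IsOpenEmbedding.id.prodMap hκ) q ?_
    ext ⟨p, z⟩
    constructor
    · rintro ⟨⟨v, c⟩, ⟨hv, -⟩, e⟩
      have hv' : v ∈ Set.range u := hur ▸ hv
      obtain ⟨s, rfl⟩ := hv'
      refine ⟨(p, s), Prod.ext rfl (Subtype.ext ?_)⟩
      change φ (u s, apex L) = z.1
      rw [← hapex c]
      exact e
    · rintro ⟨⟨p', s⟩, e⟩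
      cases e
      exact ⟨(u s, apex L), ⟨hur ▸ Set.mem_range_self s, hε⟩, rfl⟩
  · have hGe : IsTopologicalStratification (e : ℤ) L G := by
      rwa [show ((e + 1 : ℕ) : ℤ) - 1 = e by push_cast; ring] at hG
    obtain ⟨τ, hτ, hτr⟩ := exists_isOpenEmbedding_Ioo hε hε1
    have hmem : ∀ v (y : L) (t : Set.Ico (0 : ℝ) 1), (0 : ℝ) < t →
        (φ (v, OpenCone.mk y t) ∈ F ((n : ℤ) - 1) ↔ y ∈ G ((e : ℤ) - 1)) := fun v y t ht => by
      rw [hφ.apply_mem_iff, mk_mem_coneFiltration ht]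
      rw [show (n : ℤ) - 1 - d - 1 = e - 1 by push_cast at hdk; omega]
    let c : ↥(G ((e : ℤ) - 1))ᶜ × ℝ → OpenCone L := fun z =>
      OpenCone.mk z.1.1 (Set.inclusion Set.Ioo_subset_Ico_self (τ z.2))
    have hc : IsOpenEmbedding c := isOpenEmbedding_mk.comp
      ((hG'.isClosed ((e : ℤ) - 1)).isOpen_compl.isOpenEmbedding_subtypeVal.prodMap hτ)
    let κ : (EuclideanSpace ℝ (Fin d) × ℝ) × ↥(G ((e : ℤ) - 1))ᶜ → ↥(F ((n : ℤ) - 1))ᶜ :=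
      fun z => ⟨φ (u z.1.1, c (z.2, z.1.2)), fun h =>
        z.2.2 ((hmem _ _ _ (τ z.1.2).2.1).1 h)⟩
    have hκ : IsOpenEmbedding κ := by
      refine .of_comp _ hreg (hφo.comp ((hu.prodMap hc).comp
        (g := Prod.map u c) (f := fun z : (EuclideanSpace ℝ (Fin d) × ℝ) × ↥(G ((e : ℤ) - 1))ᶜ => (z.1.1, (z.2, z.1.2)))
        ?_))
      exact ((Homeomorph.prodAssoc (EuclideanSpace ℝ (Fin d)) ℝ ↥(G ((e : ℤ) - 1))ᶜ).trans
        ((Homeomorph.refl _).prodCongr (Homeomorph.prodComm _ _))).isOpenEmbedding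
    -- The ball and the radial interval are absorbed into the Euclidean factor. Carrying this factor
    -- through the induction avoids homotopy invariance and Künneth arguments.
    refine hS e rfl hGe hK (P := P × EuclideanSpace ℝ (Fin d) × ℝ)
      (θ := Prod.map id κ ∘ Homeomorph.prodAssoc _ _ _)
      ((IsOpenEmbedding.id.prodMap hκ).comp (Homeomorph.isOpenEmbedding _)) q (by omega) _ ?_
    ext ⟨p, z⟩
    constructor
    · rintro ⟨⟨v, b⟩, ⟨hv, hb⟩, hz⟩
      have hv' : v ∈ Set.range u := hur ▸ hv
      obtain ⟨s, rfl⟩ := hv'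
      -- The apex has positive codimension and so is singular, while `z` is regular.
      have hb0 : 0 < radius b := by
        refine lt_of_le_of_ne (radius_nonneg b) fun h0 => z.2 ?_
        obtain rfl := eq_apex_of_radius h0.symm
        change φ (u s, apex L) = z.1 at hz
        rw [← hz, hφ.apply_mem_iff]
        exact apex_mem_coneFiltration (by push_cast at hdk; omega)
      rcases eq_apex_or_mk b with rfl | ⟨y, t, rfl⟩
      · exact absurd hb0 (by simp)
      have hy : y ∉ G ((e : ℤ) - 1) := fun h => z.2 (by
        have := (hmem (u s) y t hb0).2 h
        change φ (u s, OpenCone.mk y t) = z.1 at hz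
        rwa [← hz])
      obtain ⟨σ, hσ⟩ := (hτr ⟨t, hb0, t.2.2⟩).2 hb
      refine ⟨((p, s, σ), ⟨y, hy⟩), Prod.ext rfl (Subtype.ext ?_)⟩
      change φ (u s, OpenCone.mk y (Set.inclusion Set.Ioo_subset_Ico_self (τ σ))) = z.1
      rw [hσ]
      exact hz
    · rintro ⟨⟨⟨p', s, σ⟩, y⟩, e⟩
      cases e
      exact ⟨(u s, c (y, σ)), ⟨hur ▸ Set.mem_range_self s, (hτr (τ σ)).1 ⟨σ, rfl⟩⟩, rfl⟩

/-- Links in a space of dimension `e` have smaller dimension, so the induction hypothesis bounds the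
local cohomology of the direct image to `L`. Compactness of `L` then gives the global bound, taken
relative to `∅`. -/
theorem linkVanishing (e : ℕ) : LinkVanishing.{u, w} e := by
  induction e using Nat.strong_induction_on with
  | _ e IH =>
  intro L _ _ _ F hF P _ _ _ Y _ K hK θ hθ q hq V hV
  refine VanOn.of_eq (V := imageOpens hθ ⊤) ?_ (Opens.ext (by rw [hV]; exact Set.image_univ))
  let M := (K.pullback hθ).pushforward (regularProj P (F ((e : ℤ) - 1)))
  have hM : M.VanAbove e (Set.range id) := by
    refine vanAbove_of_stratification M e hF continuous_id Function.injective_id ?_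
    intro d k hdk y hy q hq
    exact locEx_of_linkVanishing hF (hK.pullback hθ) hdk (fun e' he' => IH e' (by omega)) hy hq
  intro α hα
  obtain ⟨β, -, hβ⟩ := hM q hq ∅ isClosed_empty α (fun x _ => by
    have : M.d (q + 1) ⊤ α = 0 := hα
    rw [this]
    exact zeroNear_zero x) (by simp)
  exact ⟨β, sub_eq_zero.1 (eq_zero_of_zeroNear (K := M) fun x => hβ x ⟨x, rfl⟩)⟩

end FlasqueComplex

/-! ### Derived functors and truncations on representing complexes -/

section Derived

attribute [local instance] HasDerivedCategory.standard

variable {C D : Type*} [Category* C] [Category* D] [Abelian C] [Abelian D]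
  [HasDerivedCategory C] [HasDerivedCategory D]

/-- The right derived functor is computed by bounded below complexes of injective objects. -/
theorem nonempty_rightDerivedFunctorPlus_iso [EnoughInjectives C] (F : C ⥤ D) [F.Additive]
    (K : CochainComplex.Plus C) [∀ n, Injective (K.obj.X n)] :
    Nonempty (F.rightDerivedFunctorPlus.obj (DerivedCategory.Plus.Q.obj K) ≅
      DerivedCategory.Plus.Q.obj (F.mapCochainComplexPlus.obj K)) := by
  have : IsIso (F.rightDerivedFunctorPlusUnit.app ((HomotopyCategory.Plus.quotient C).obj K)) :=
    inferInstance
  exact ⟨(asIso (F.rightDerivedFunctorPlusUnit.app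
    ((HomotopyCategory.Plus.quotient C).obj K))).symm⟩

/-- The homology of the image of a complex in the derived category. -/
theorem nonempty_homologyFunctor_Q_iso (K : CochainComplex.Plus C) (i : ℤ) :
    Nonempty ((DerivedCategory.Plus.homologyFunctor C i).obj (DerivedCategory.Plus.Q.obj K) ≅
      K.obj.homology i) :=
  ⟨(DerivedCategory.homologyFunctorFactors C i).app K.obj⟩

theorem nonempty_truncLE_iso (K : CochainComplex.Plus C) (m : ℤ)
    (h : ∀ i, m < i → K.obj.ExactAt i) :
    Nonempty ((DerivedCategory.Plus.TStructure.t.truncLE m).obj (DerivedCategory.Plus.Q.obj K) ≅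
      DerivedCategory.Plus.Q.obj K) := by
  have : (DerivedCategory.Plus.Q.obj K).IsLE m := by
    rw [← DerivedCategory.Plus.isLE_ι_obj_iff, DerivedCategory.isLE_iff]
    intro i hi
    exact ((h i hi).isZero_homology).of_iso (nonempty_homologyFunctor_Q_iso K i).some
  exact ⟨asIso ((DerivedCategory.Plus.TStructure.t.truncLEι m).app _)⟩

end Derived

/-! ### Injective sheaves: direct images and flasqueness -/

section Pushforward

variable {R : Type u} [CommRing R]

theorem mono_hom_of_mono {Y : TopCat.{u}}
    {A B : Sheaf (Opens.grothendieckTopology Y) (ModuleCat.{u} R)} (g : A ⟶ B) (_ : Mono g) :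
    Mono g.hom :=
  inferInstanceAs (Mono ((sheafToPresheaf _ _).map g))

/-- The left adjoint is restriction to an open subset, which preserves monomorphisms. -/
theorem injective_pushforward {Y Z : TopCat.{u}} {f : Y ⟶ Z} (hf : IsOpenEmbedding f) (I : Sh R Y)
    [Injective I] : Injective ((TopCat.Sheaf.pushforward (ModuleCat.{u} R) f).obj I) := by
  have : (TopCat.Sheaf.pullback (ModuleCat.{u} R) f).PreservesMonomorphisms := by
    have : (hf.sheafPullback (ModuleCat.{u} R)).PreservesMonomorphisms := by
      constructor
      intro A B g hg
      have h1 : Mono g.hom := mono_hom_of_mono g hg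
      have h2 : ∀ V, Mono (g.hom.app V) := (NatTrans.mono_iff_mono_app _).1 h1
      have h3 : Mono ((hf.sheafPullback (ModuleCat.{u} R)).map g).hom :=
        (NatTrans.mono_iff_mono_app _).2 fun V => h2 _
      exact Sheaf.Hom.mono_of_presheaf_mono _ _ _
    exact Functor.PreservesMonomorphisms.of_iso (hf.sheafPullbackIso (ModuleCat.{u} R)).symm
  exact (TopCat.Sheaf.pullbackPushforwardAdjunction (ModuleCat.{u} R) f).map_injective _ ‹_›

/-- Sections over `V` are maps to `I` from the sheafified free module on the presheaf represented by
`V`. They extend along the monomorphism to the one for `W` because `I` is injective. -/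
theorem surjective_res_of_injective {Y : TopCat.{u}}
    (I : Sheaf (Opens.grothendieckTopology Y) (ModuleCat.{u} R)) [Injective I] {V W : Opens Y}
    (h : V ≤ W) : Function.Surjective (I.obj.map (homOfLE h).op) := by
  let J := Opens.grothendieckTopology Y
  let A : ((Opens Y)ᵒᵖ ⥤ Type u) ⥤ ((Opens Y)ᵒᵖ ⥤ ModuleCat.{u} R) :=
    (Functor.whiskeringRight _ _ _).obj (ModuleCat.free R)
  let adj := (Adjunction.whiskerRight (Opens Y)ᵒᵖ (ModuleCat.adj R)).comp
    (sheafificationAdjunction J (ModuleCat.{u} R))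
  let i : V ⟶ W := homOfLE h
  have hA : Mono (A.map (yoneda.map i)) := by
    refine (NatTrans.mono_iff_mono_app _).2 fun U => ?_
    rw [ModuleCat.mono_iff_injective]
    exact Finsupp.mapDomain_injective fun a b _ =>
      (inferInstance : Subsingleton (U.unop ⟶ V)).elim a b
  have hm : Mono ((A ⋙ presheafToSheaf J (ModuleCat.{u} R)).map (yoneda.map i)) :=
    inferInstanceAs (Mono ((presheafToSheaf J (ModuleCat.{u} R)).map (A.map (yoneda.map i))))
  intro s
  let x : yoneda.obj V ⟶ I.obj ⋙ forget (ModuleCat.{u} R) := yonedaEquiv.symm s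
  let f := (adj.homEquiv _ I).symm x
  let g := Injective.factorThru f ((A ⋙ presheafToSheaf J (ModuleCat.{u} R)).map (yoneda.map i))
  have hg : (A ⋙ presheafToSheaf J (ModuleCat.{u} R)).map (yoneda.map i) ≫ g = f :=
    Injective.comp_factorThru _ _
  refine ⟨yonedaEquiv (adj.homEquiv _ I g), ?_⟩
  have e : yoneda.map i ≫ adj.homEquiv _ I g = x := by
    rw [← adj.homEquiv_naturality_left]
    exact ((adj.homEquiv _ I).eq_symm_apply).1 hg
  have e' := yonedaEquiv_naturality (adj.homEquiv _ I g) i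
  erw [e, Equiv.apply_symm_apply] at e'
  exact e'

end Pushforward

/-! ### Flasque complexes from complexes of sheaves; exactness on sections -/

section Sections

variable {R : Type u} [CommRing R]

/-- The flasque complex of sections of a complex of sheaves in non-negative degrees. -/
@[reducible] def FlasqueComplex.ofComplex {Y : TopCat.{u}} (I : CochainComplex (Sh R Y) ℤ)
    (hI : ∀ (q : ℤ) {V W : Opens Y} (h : V ≤ W),
      Function.Surjective ((I.X q).obj.map (homOfLE h).op)) :
    FlasqueComplex.{u, u} Y where
  obj q V := (I.X q).obj.obj (.op V)
  res q _ _ h := ((I.X q).obj.map (homOfLE h).op).hom.toAddMonoidHom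
  res_self h s := by
    change (I.X _).obj.map (𝟙 _) s = s
    simp
  res_res h h' s := by
    change (I.X _).obj.map _ ((I.X _).obj.map _ s) = (I.X _).obj.map _ s
    rw [← ConcreteCategory.comp_apply, ← Functor.map_comp]
    rfl
  d q V := ((I.d q ((q + 1 : ℕ) : ℤ)).hom.app (.op V)).hom.toAddMonoidHom
  d_d {q V} s := by
    have := congrArg (fun f => f.hom.app (.op V) s) (I.d_comp_d q (q + 1 : ℕ) (q + 1 + 1 : ℕ))
    exact this
  d_res {q V W} h s := by
    have := congrArg (fun f => f s) ((I.d q ((q + 1 : ℕ) : ℤ)).hom.naturality (homOfLE h).op)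
    exact this
  sep {q V} s hs := by
    choose W hW hx hs using fun x : V => hs x.1 x.2
    refine TopCat.Sheaf.eq_of_locally_eq' (I.X q) W V (fun x => homOfLE (hW x))
      (fun x hx' => ?_) s 0 fun x => ?_
    · exact Opens.mem_iSup.2 ⟨⟨x, hx'⟩, hx ⟨x, hx'⟩⟩
    · rw [map_zero]
      exact hs x
  glue {q ι} V U hV hU s hs := by
    obtain ⟨t, ht, -⟩ := TopCat.Sheaf.existsUnique_gluing' (I.X q) V U (fun i => homOfLE (hV i))
      (fun x hx => Opens.mem_iSup.2 (hU x hx)) s fun i j => hs i j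
    exact ⟨t, ht⟩
  flasque h := hI _ h

end Sections

variable {R : Type u} [CommRing R] {Y : TopCat.{u}}

/-- The functor of sections over an open set. -/
abbrev sectionsFunctor (R : Type u) [CommRing R] {Y : TopCat.{u}} (V : Opens Y) :
    Sheaf (Opens.grothendieckTopology Y) (ModuleCat.{u} R) ⥤ ModuleCat.{u} R :=
  (sheafSections (Opens.grothendieckTopology Y) (ModuleCat.{u} R)).obj (.op V)

theorem preservesFiniteLimits_sections (V : Opens Y) :
    Limits.PreservesFiniteLimits (sectionsFunctor R V) := by
  have : Limits.PreservesFiniteLimits ((evaluation (Opens Y)ᵒᵖ (ModuleCat.{u} R)).obj (.op V)) :=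
    inferInstance
  exact inferInstanceAs (Limits.PreservesFiniteLimits
    (sheafToPresheaf (Opens.grothendieckTopology Y) (ModuleCat.{u} R) ⋙
      (evaluation (Opens Y)ᵒᵖ (ModuleCat.{u} R)).obj (.op V)))

theorem sections_exact (S : ShortComplex (Sheaf (Opens.grothendieckTopology Y) (ModuleCat.{u} R)))
    (hS : S.Exact) (hf : Mono S.f) (V : Opens Y) :
    Function.Injective (S.f.hom.app (.op V)) ∧ ∀ s, S.g.hom.app (.op V) s = 0 →
      ∃ t, S.f.hom.app (.op V) t = s := by
  have := preservesFiniteLimits_sections (R := R) V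
  constructor
  · exact (ModuleCat.mono_iff_injective _).1
      (inferInstanceAs (Mono ((sectionsFunctor R V).map S.f)))
  · have h : (S.map (sectionsFunctor R V)).Exact :=
      hS.map_of_mono_of_preservesKernel (sectionsFunctor R V) hf inferInstance
    exact (ShortComplex.moduleCat_exact_iff _).1 h

/-- Exactness means that the map to the cycles is an epimorphism, i.e. locally surjective. By left
exactness, sections of the cycles are exactly the sections killed by `S.g`. -/
theorem exact_iff_locally
    (S : ShortComplex (Sheaf (Opens.grothendieckTopology Y) (ModuleCat.{u} R))) :
    S.Exact ↔ ∀ (V : Opens Y) (s : S.X₂.obj.obj (.op V)), S.g.hom.app (.op V) s = 0 →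
      ∀ x ∈ V, ∃ (W : Opens Y) (h : W ≤ V), x ∈ W ∧
        ∃ t, S.f.hom.app (.op W) t = S.X₂.obj.map (homOfLE h).op s := by
  have hT : (ShortComplex.mk S.iCycles S.g S.iCycles_g).Exact :=
    ShortComplex.exact_of_f_is_kernel _ S.cyclesIsKernel
  have hi := sections_exact _ hT inferInstance
  have hf : ∀ (W : Opens Y) (t : S.X₁.obj.obj (.op W)),
      S.iCycles.hom.app (.op W) (S.toCycles.hom.app (.op W) t) = S.f.hom.app (.op W) t :=
    fun W t => congrArg (fun f => f.hom.app (.op W) t) S.toCycles_i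
  have hr : ∀ {V W : Opens Y} (h : W ≤ V) (z : S.cycles.obj.obj (.op V)),
      S.iCycles.hom.app (.op W) (S.cycles.obj.map (homOfLE h).op z) =
        S.X₂.obj.map (homOfLE h).op (S.iCycles.hom.app (.op V) z) :=
    fun h z => congrArg (fun f => f z) (S.iCycles.hom.naturality (homOfLE h).op)
  rw [ShortComplex.exact_iff_epi_toCycles, ← CategoryTheory.Sheaf.isLocallySurjective_iff_epi']
  refine Iff.trans (TopCat.Presheaf.isLocallySurjective_iff S.toCycles.hom) ?_
  constructor
  · intro h V s hs x hx
    obtain ⟨z, rfl⟩ := (hi V).2 s hs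
    obtain ⟨W, hW, ⟨t, ht⟩, hxW⟩ := h V z x hx
    refine ⟨W, hW, hxW, t, ?_⟩
    have e := (hf W t).symm.trans (congrArg _ ht)
    exact e.trans (hr hW z)
  · intro h V z x hx
    obtain ⟨W, hW, hxW, t, ht⟩ := h V (S.iCycles.hom.app (.op V) z)
      (congrArg (fun f => f.hom.app (.op V) z) S.iCycles_g) x hx
    refine ⟨W, hW, ⟨t, (hi W).1 ?_⟩, hxW⟩
    exact (hf W t).trans (ht.trans (hr hW z).symm)

theorem exactAt_iff_locEx (I : CochainComplex (Sh R Y) ℤ)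
    (hI : ∀ (q : ℤ) {V W : Opens Y} (h : V ≤ W),
      Function.Surjective ((I.X q).obj.map (homOfLE h).op)) (q : ℕ) :
    I.ExactAt ((q + 1 : ℕ) : ℤ) ↔ ∀ x, (FlasqueComplex.ofComplex I hI).LocEx q x := by
  rw [I.exactAt_iff' (q : ℤ) ((q + 1 : ℕ) : ℤ) ((q + 1 + 1 : ℕ) : ℤ) (by simp) (by simp)]
  refine (exact_iff_locally _).trans ?_
  exact ⟨fun h x V hx s hs => h V s hs x hx, fun h V s hs x hx => h x V hx s hs⟩

/-! ### Restriction maps of locally constant sheaves -/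

section LocallyConstant

variable {R : Type u} [CommRing R] {Y : TopCat.{u}}

/-- The restriction maps between preconnected open subsets of `V` are bijective, those from a
preconnected to a non-empty open subset are injective. -/
def ConstantOn (F : Sheaf (Opens.grothendieckTopology Y) (ModuleCat.{u} R)) (V : Opens Y) : Prop :=
  ∀ (W' W : Opens Y) (h : W' ≤ W), W ≤ V → _root_.IsPreconnected (W : Set Y) →
    (W' : Set Y).Nonempty →
    (∀ s : F.obj.obj (.op W), F.obj.map (homOfLE h).op s = 0 → s = 0) ∧
    (_root_.IsPreconnected (W' : Set Y) → Function.Surjective (F.obj.map (homOfLE h).op))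

theorem ConstantOn.of_iso {F F' : Sheaf (Opens.grothendieckTopology Y) (ModuleCat.{u} R)}
    (e : F ≅ F') {V : Opens Y} (hF : ConstantOn F V) : ConstantOn F' V := by
  intro W' W h hW hc hne
  obtain ⟨h1, h2⟩ := hF W' W h hW hc hne
  have n1 : ∀ s, e.hom.hom.app (.op W') (F.obj.map (homOfLE h).op s) =
      F'.obj.map (homOfLE h).op (e.hom.hom.app (.op W) s) :=
    fun s => congrArg (fun f => f s) (e.hom.hom.naturality (homOfLE h).op)
  have n2 : ∀ s, e.inv.hom.app (.op W') (F'.obj.map (homOfLE h).op s) =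
      F.obj.map (homOfLE h).op (e.inv.hom.app (.op W) s) :=
    fun s => congrArg (fun f => f s) (e.inv.hom.naturality (homOfLE h).op)
  have i1 : ∀ (U : Opens Y) s, e.hom.hom.app (.op U) (e.inv.hom.app (.op U) s) = s :=
    fun U s => congrArg (fun f => f.hom.app (.op U) s) e.inv_hom_id
  refine ⟨fun s hs => ?_, fun hc' s' => ?_⟩
  · rw [← i1 W s, h1 (e.inv.hom.app (.op W) s) (by rw [← n2, hs, map_zero]), map_zero]
  · obtain ⟨s, hs⟩ := h2 hc' (e.inv.hom.app (.op W') s')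
    exact ⟨e.hom.hom.app (.op W) s, by rw [← n1, hs, i1]⟩

/-- Sections are locally given by elements of `M`, and such an element is determined on any nonempty
open set. Local vanishing of a section is thus locally constant, and a section on a connected set is
determined by one local value. -/
theorem constantOn_constantSheaf (M : ModuleCat.{u} R) (V : Opens Y) :
    ConstantOn ((constantSheaf (Opens.grothendieckTopology Y) (ModuleCat.{u} R)).obj M) V := by
  set F := (constantSheaf (Opens.grothendieckTopology Y) (ModuleCat.{u} R)).obj M with hF
  let η : (Functor.const (Opens Y)ᵒᵖ).obj M ⟶ F.obj :=
    toSheafify (Opens.grothendieckTopology Y) _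
  have hη : Presheaf.IsLocallyInjective (Opens.grothendieckTopology Y) η :=
    inferInstanceAs (Presheaf.IsLocallyInjective _ (toSheafify (Opens.grothendieckTopology Y) _))
  have hη' : Presheaf.IsLocallySurjective (Opens.grothendieckTopology Y) η :=
    inferInstanceAs (Presheaf.IsLocallySurjective _ (toSheafify (Opens.grothendieckTopology Y) _))
  have nat : ∀ {U U' : Opens Y} (h : U' ≤ U) (m : M),
      F.obj.map (homOfLE h).op (η.app (.op U) m) = η.app (.op U') m :=
    fun h m => congrArg (fun f => f m) (η.naturality (homOfLE h).op).symm
  have res : ∀ {U U' U'' : Opens Y} (h : U' ≤ U) (h' : U'' ≤ U') (s : F.obj.obj (.op U)),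
      F.obj.map (homOfLE h').op (F.obj.map (homOfLE h).op s) =
        F.obj.map (homOfLE (h'.trans h)).op s := fun h h' s => by
    rw [← ConcreteCategory.comp_apply, ← Functor.map_comp]
    rfl
  have inj : ∀ (U : Opens Y) (m : M), (U : Set Y).Nonempty → η.app (.op U) m = 0 → m = 0 := by
    rintro U m ⟨x, hx⟩ hm
    obtain ⟨W, i, hi, -⟩ := Presheaf.equalizerSieve_mem (Opens.grothendieckTopology Y) η
      (X := .op U) m (0 : M) (hm.trans (map_zero _).symm) x hx
    exact hi
  have surj : ∀ (U : Opens Y) (s : F.obj.obj (.op U)), ∀ x ∈ U, ∃ (W : Opens Y) (h : W ≤ U),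
      x ∈ W ∧ ∃ m : M, η.app (.op W) m = F.obj.map (homOfLE h).op s := by
    intro U s x hx
    obtain ⟨W, i, ⟨t, ht⟩, hxW⟩ := Presheaf.imageSieve_mem (Opens.grothendieckTopology Y) η s x hx
    exact ⟨W, leOfHom i, hxW, t, ht⟩
  have key : ∀ {W' W : Opens Y} (h : W' ≤ W), _root_.IsPreconnected (W : Set Y) →
      (W' : Set Y).Nonempty → ∀ s : F.obj.obj (.op W), F.obj.map (homOfLE h).op s = 0 → s = 0 := by
    intro W' W h hc hne s hs
    let P : Y → Prop := fun x => ∃ (N : Opens Y) (hN : N ≤ W), x ∈ N ∧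
      F.obj.map (homOfLE hN).op s = 0
    obtain ⟨y, hy⟩ := hne
    have hP : ∀ x ∈ W, P x := by
      intro x hx
      refine (hc.induction₂ (fun a b => P a ↔ P b) ?_ (fun _ _ _ _ _ _ => Iff.trans)
        (fun _ _ _ _ => Iff.symm) (h hy) hx).1 ⟨W', h, hy, hs⟩
      intro a ha
      obtain ⟨N, hN, haN, m, hm⟩ := surj W s a ha
      have : ∀ b ∈ N, P b ↔ m = 0 := by
        refine fun b hb => ⟨?_, ?_⟩
        · rintro ⟨N', hN', hb', h0⟩
          refine inj (N' ⊓ N) m ⟨b, hb', hb⟩ ?_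
          rw [← nat inf_le_right, hm, res, ← res hN' inf_le_left, h0, map_zero]
        · rintro rfl
          exact ⟨N, hN, hb, by rw [← hm, map_zero]⟩
      filter_upwards [mem_nhdsWithin_of_mem_nhds (N.2.mem_nhds haN)] with b hb
      exact (this a haN).trans (this b hb).symm
    choose N hN hxN h0 using fun x : W => hP x.1 x.2
    refine TopCat.Sheaf.eq_of_locally_eq' F N W (fun x => homOfLE (hN x))
      (fun x hx => Opens.mem_iSup.2 ⟨⟨x, hx⟩, hxN ⟨x, hx⟩⟩) s 0 fun x => ?_
    rw [map_zero]
    exact h0 x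
  intro W' W h _ hc hne
  refine ⟨key h hc hne, fun hc' s' => ?_⟩
  obtain ⟨y, hy⟩ := hne
  obtain ⟨N, hN, hyN, m, hm⟩ := surj W' s' y hy
  refine ⟨η.app (.op W) m, ?_⟩
  rw [← sub_eq_zero]
  refine key hN hc' ⟨y, hyN⟩ _ ?_
  rw [map_sub, nat, ← hm, nat, sub_self]

theorem ConstantOn.of_sheafRestrict
    {F : Sheaf (Opens.grothendieckTopology Y) (ModuleCat.{u} R)} {V : Opens Y}
    (h : ConstantOn (Y := TopCat.of V) (V.sheafRestrict.obj F) ⊤) : ConstantOn F V := by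
  let φ := (V.isOpenEmbedding).isOpenMap.functor
  have key : ∀ W' W : Opens V, (h : φ.obj W' ≤ φ.obj W) →
      _root_.IsPreconnected (φ.obj W : Set Y) → (φ.obj W' : Set Y).Nonempty →
      (∀ s : F.obj.obj (.op (φ.obj W)), F.obj.map (homOfLE h).op s = 0 → s = 0) ∧
        (_root_.IsPreconnected (φ.obj W' : Set Y) →
          Function.Surjective (F.obj.map (homOfLE h).op)) := by
    intro W' W hh hc hne
    have hle : W' ≤ W := (Set.image_subset_image_iff Subtype.val_injective).1 hh
    obtain ⟨h1, h2⟩ := h W' W hle le_top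
      ((V.isOpenEmbedding.isInducing.isPreconnected_image).1 hc) hne.of_image
    exact ⟨h1, fun hc' => h2 ((V.isOpenEmbedding.isInducing.isPreconnected_image).1 hc')⟩
  have hex : ∀ W : Opens Y, W ≤ V → ∃ W₁ : Opens V, φ.obj W₁ = W := by
    intro W hW
    refine ⟨W.comap ⟨Subtype.val, continuous_subtype_val⟩, Opens.ext ?_⟩
    exact (Subtype.image_preimage_coe _ _).trans (Set.inter_eq_right.2 hW)
  intro W' W hW hWV hc hne
  obtain ⟨W₁, rfl⟩ := hex W hWV
  obtain ⟨W₁', rfl⟩ := hex W' (hW.trans hWV)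
  exact key W₁' W₁ hW hc hne

end LocallyConstant

/-! ### Injective resolutions of local systems -/

section Resolution

attribute [local instance] HasDerivedCategory.standard

variable {R : Type u} [CommRing R] {Y : TopCat.{u}}

theorem nonempty_homology_single_iso (G : Sh R Y) :
    Nonempty ((DerivedCategory.Plus.homologyFunctor (Sh R Y) 0).obj (single G) ≅ G) :=
  ⟨(DerivedCategory.singleFunctorCompHomologyFunctorIso (Sh R Y) 0).app G⟩

theorem exists_injective_resolution (G : Sh R Y) :
    ∃ I : CochainComplex.Plus (Sh R Y), (∀ n, Injective (I.obj.X n)) ∧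
      Nonempty (DerivedCategory.Plus.Q.obj I ≅ single G) ∧
      Nonempty (I.obj.cycles 0 ≅ G) ∧ (∀ i : ℤ, 0 < i → I.obj.ExactAt i) := by
  have : DerivedCategory.Plus.IsGE (single G) 0 :=
    inferInstanceAs (((DerivedCategory.Plus.singleFunctor (Sh R Y) 0).obj G).IsGE 0)
  obtain ⟨L, hL, ⟨e⟩⟩ := DerivedCategory.Plus.exists_injective_nonempty_iso (single G) 0
  let I := (InjectiveObject.ι (Sh R Y)).mapCochainComplexPlus.obj L
  have hz : Limits.IsZero (L.obj.X (-1)) := L.obj.isZero_of_isStrictlyGE 0 (-1) (by simp)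
  -- Nothing enters degree `0`, so the homology there is the sheaf of cycles.
  have hd : I.obj.d (-1) 0 = 0 := by
    change (InjectiveObject.ι (Sh R Y)).map (L.obj.d (-1) 0) = 0
    rw [hz.eq_of_src (L.obj.d (-1) 0) 0, Functor.map_zero]
  refine ⟨I, fun n => (L.obj.X n).property, ⟨e⟩, ⟨?_⟩, fun i hi => ?_⟩
  · exact I.obj.isoHomologyπ (-1) 0 (by simp) hd ≪≫
      (nonempty_homologyFunctor_Q_iso I 0).some.symm ≪≫
      (DerivedCategory.Plus.homologyFunctor (Sh R Y) 0).mapIso e ≪≫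
      (nonempty_homology_single_iso G).some
  · rw [HomologicalComplex.exactAt_iff_isZero_homology]
    have : DerivedCategory.Plus.IsLE (single G) 0 :=
      inferInstanceAs (((DerivedCategory.Plus.singleFunctor (Sh R Y) 0).obj G).IsLE 0)
    exact ((single G).isZero_homology_of_isLE 0 i hi).of_iso
      ((nonempty_homologyFunctor_Q_iso I i).some.symm ≪≫
      (DerivedCategory.Plus.homologyFunctor (Sh R Y) i).mapIso e)

theorem IsLocalSystem.isResolution {G : Sh R Y} (hG : IsLocalSystem G)
    (I : CochainComplex (Sh R Y) ℤ)
    (hI : ∀ (q : ℤ) {V W : Opens Y} (h : V ≤ W),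
      Function.Surjective ((I.X q).obj.map (homOfLE h).op))
    (e : I.cycles 0 ≅ G) (hex : ∀ i : ℤ, 0 < i → I.ExactAt i) :
    (FlasqueComplex.ofComplex I hI).IsResolution where
  locEx q x := (exactAt_iff_locEx I hI q).1 (hex _ (by positivity)) x
  locConst y := by
    obtain ⟨V, hy, M, -, ⟨e'⟩⟩ := hG y
    have hV : ConstantOn (I.cycles 0) V :=
      ConstantOn.of_iso e.symm (ConstantOn.of_sheafRestrict
        (ConstantOn.of_iso e'.symm (constantOn_constantSheaf M ⊤)))
    have hT : (ShortComplex.mk (I.iCycles 0) (I.d 0 1) (I.iCycles_d 0 1)).Exact :=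
      ShortComplex.exact_of_f_is_kernel _ (I.cyclesIsKernel 0 1 (by simp))
    have hi := sections_exact _ hT (inferInstanceAs (Mono (I.iCycles 0)))
    have hr : ∀ {V W : Opens Y} (h : W ≤ V) (z : (I.cycles 0).obj.obj (.op V)),
        (I.iCycles 0).hom.app (.op W) ((I.cycles 0).obj.map (homOfLE h).op z) =
          (I.X 0).obj.map (homOfLE h).op ((I.iCycles 0).hom.app (.op V) z) :=
      fun h z => congrArg (fun f => f z) ((I.iCycles 0).hom.naturality (homOfLE h).op)
    have hd : ∀ (V : Opens Y) (z : (I.cycles 0).obj.obj (.op V)),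
        (I.d 0 1).hom.app (.op V) ((I.iCycles 0).hom.app (.op V) z) = 0 :=
      fun V z => congrArg (fun f => f.hom.app (.op V) z) (I.iCycles_d 0 1)
    refine ⟨V, hy, fun W' W h hW hc hne => ?_⟩
    obtain ⟨h1, h2⟩ := hV W' W h hW hc hne
    refine ⟨fun s hs hs' => ?_, fun hc' s' hs' => ?_⟩
    · obtain ⟨z, rfl⟩ := (hi W).2 s hs
      refine (congrArg _ (h1 z ((hi W').1 ?_))).trans (map_zero _)
      exact (hr h z).trans (hs'.trans (map_zero _).symm)
    · obtain ⟨z', rfl⟩ := (hi W').2 s' hs'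
      obtain ⟨z, rfl⟩ := h2 hc' z'
      exact ⟨(I.iCycles 0).hom.app (.op W) z, hd W z, (hr h z).symm⟩

end Resolution

/-! ### Local vanishing for the direct image from the regular part -/

namespace FlasqueComplex

section

variable {Y : Type v} [TopologicalSpace Y] {K : FlasqueComplex.{v, w} Y}

/-- A further direct image along an open embedding does not change germs at points of its image, so
exactness on `U_k` may be tested on `X`. -/
theorem LocEx.of_comp {Z X : Type*} [TopologicalSpace Z] [TopologicalSpace X] {f : C(Y, Z)}
    {e : C(Z, X)} (he : IsOpenEmbedding e) {q : ℕ} {z : Z}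
    (h : (K.pushforward (e.comp f)).LocEx q (e z)) : (K.pushforward f).LocEx q z := by
  intro V hz α hα
  have hV : (imageOpens he V).comap (e.comp f) ≤ V.comap f := by
    rintro y ⟨z', hz', hy⟩
    have : z' = f y := he.injective hy
    change f y ∈ V
    exact this ▸ hz'
  obtain ⟨W, hW, hzW, β, hβ⟩ := h (imageOpens he V) ⟨z, hz, rfl⟩ (K.res _ hV α)
    ((K.d_res hV α).trans ((congrArg _ hα).trans (map_zero _)))
  refine ⟨W.comap e, fun z' hz' => ?_, hzW, β, hβ.trans (K.res_res _ _ _)⟩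
  obtain ⟨z'', h1, h2⟩ := hW hz'
  exact he.injective h2 ▸ h1

theorem IsResolution.pushforward_homeomorph (hK : K.IsResolution) {Z : Type*} [TopologicalSpace Z]
    (e : Y ≃ₜ Z) : (K.pushforward (e : C(Y, Z))).IsResolution where
  locEx q z := by
    refine LocEx.of_comp (e := (e.symm : C(Z, Y))) e.symm.isOpenEmbedding ?_
    have : (e.symm : C(Z, Y)).comp (e : C(Y, Z)) = ContinuousMap.id Y := by
      ext y
      exact e.symm_apply_apply y
    rw [this]
    exact hK.locEx q (e.symm z)
  locConst z := by
    obtain ⟨V, hy, hV⟩ := hK.locConst (e.symm z)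
    refine ⟨V.comap (e.symm : C(Z, Y)), hy, fun W' W h hW hc hne => ?_⟩
    have hpre : ∀ U : Set Z, _root_.IsPreconnected U → _root_.IsPreconnected (e ⁻¹' U) :=
      fun U hU => e.isPreconnected_preimage.2 hU
    obtain ⟨h1, h2⟩ := hV (W'.comap (e : C(Y, Z))) (W.comap (e : C(Y, Z))) (fun _ hx => h hx)
      (fun y hy => by
        have : e.symm (e y) ∈ V := hW hy
        rwa [e.symm_apply_apply] at this) (hpre _ hc) (hne.preimage e.surjective)
    exact ⟨h1, fun hc' => h2 (hpre _ hc')⟩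

end

/-- The direct image of a resolution of a locally constant sheaf on the regular part has no
cohomology in degrees `≥ max(k, 1)` at a point of codimension `k`. -/
theorem locEx_pushforward_regular {n : ℕ} {X : Type u} [TopologicalSpace X] {F : ℤ → Set X}
    (hF : IsTopologicalStratification n X F) {K : FlasqueComplex.{u, w} ↥(F ((n : ℤ) - 1))ᶜ}
    (hK : K.IsResolution) {d k : ℕ} (hdk : (d : ℤ) + k = n) {x : X} (hx : x ∈ F d \ F (d - 1))
    {q : ℕ} (hq : k - 1 ≤ q) : (K.pushforward ⟨Subtype.val, continuous_subtype_val⟩).LocEx q x := by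
  -- The Euclidean factor is a point here.
  let e : ↥(F ((n : ℤ) - 1))ᶜ ≃ₜ EuclideanSpace ℝ (Fin 0) × ↥(F ((n : ℤ) - 1))ᶜ :=
    (Homeomorph.uniqueProd _ _).symm
  exact locEx_of_linkVanishing hF (hK.pushforward_homeomorph e) hdk
    (fun e _ => linkVanishing e) hx hq

end FlasqueComplex

/-! ### Direct images and hypercohomology via injective complexes -/

section Main

attribute [local instance] HasDerivedCategory.standard

variable {R : Type u} [CommRing R]

/-- Direct images of complexes. -/
noncomputable abbrev pushComplex {Y Z : TopCat.{u}} (f : Y ⟶ Z) (I : CochainComplex.Plus (Sh R Y)) :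
    CochainComplex.Plus (Sh R Z) :=
  (TopCat.Sheaf.pushforward (ModuleCat.{u} R) f).mapCochainComplexPlus.obj I

theorem nonempty_derivedPushforward_iso {Y Z : TopCat.{u}} (f : Y ⟶ Z)
    (I : CochainComplex.Plus (Sh R Y)) [∀ n, Injective (I.obj.X n)] :
    Nonempty ((derivedPushforward f).obj (DerivedCategory.Plus.Q.obj I) ≅
      DerivedCategory.Plus.Q.obj (pushComplex f I)) :=
  nonempty_rightDerivedFunctorPlus_iso _ _

theorem injective_pushComplex {Y Z : TopCat.{u}} {f : Y ⟶ Z} (hf : IsOpenEmbedding f)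
    {I : CochainComplex.Plus (Sh R Y)} (hI : ∀ n, Injective (I.obj.X n)) (n : ℤ) :
    Injective ((pushComplex f I).obj.X n) :=
  have := hI n
  injective_pushforward hf (I.obj.X n)

theorem nonempty_hypercohomology_iso {Y : TopCat.{u}} (I : CochainComplex.Plus (Sh R Y))
    [∀ n, Injective (I.obj.X n)] (i : ℤ) :
    Nonempty (hypercohomology (DerivedCategory.Plus.Q.obj I) i ≅
      ((globalSections R Y).mapCochainComplexPlus.obj I).obj.homology i) :=
  ⟨(DerivedCategory.Plus.homologyFunctor (ModuleCat.{u} R) i).mapIso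
    (nonempty_rightDerivedFunctorPlus_iso _ _).some ≪≫ (nonempty_homologyFunctor_Q_iso _ i).some⟩

/-- The cohomology of the direct image. -/
theorem nonempty_hypercohomology_pushComplex_iso {Y Z : TopCat.{u}} {f : Y ⟶ Z}
    (hf : IsOpenEmbedding f) (I : CochainComplex.Plus (Sh R Y))
    (hI : ∀ n, Injective (I.obj.X n)) (i : ℤ) :
    Nonempty (hypercohomology (DerivedCategory.Plus.Q.obj (pushComplex f I)) i ≅
      hypercohomology (DerivedCategory.Plus.Q.obj I) i) :=
  have := injective_pushComplex hf hI
  -- The complexes of global sections of `f_* I` and of `I` are the same by definition.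
  ⟨(nonempty_hypercohomology_iso (pushComplex f I) i).some ≪≫
    (nonempty_hypercohomology_iso I i).some.symm⟩

end Main

/-! ### Identification of the Deligne sheaf -/

section Comparison

attribute [local instance] HasDerivedCategory.standard

variable {R : Type u} [CommRing R] {n : ℕ} {X : Type u} [TopologicalSpace X]
  (S : PseudomanifoldStratification n X)

/-- The inclusion of `U_k` in `X` as a continuous map. -/
def PseudomanifoldStratification.val (k : ℕ) : C(S.space k, X) :=
  ⟨Subtype.val, continuous_subtype_val⟩

theorem PseudomanifoldStratification.isOpenEmbedding_val (k : ℕ) : IsOpenEmbedding (S.val k) :=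
  (S.U k).2.isOpenEmbedding_subtypeVal

theorem PseudomanifoldStratification.isOpenEmbedding_of_comp {j k : ℕ} (f : S.space j ⟶ S.space k)
    (hf : (S.val k).comp f.hom = S.val j) : IsOpenEmbedding f := by
  refine .of_comp f (S.isOpenEmbedding_val k) ?_
  change IsOpenEmbedding ((S.val k).comp f.hom)
  rw [hf]
  exact S.isOpenEmbedding_val j

/-- The direct image to `U_{k+1}` of a resolution of a local system on the regular part is exact in
degrees `≥ k`. -/
theorem exactAt_pushComplex (I : CochainComplex.Plus (Sh R (S.space 1)))
    (hI : ∀ (q : ℤ) {V W : Opens (S.space 1)} (h : V ≤ W),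
      Function.Surjective ((I.obj.X q).obj.map (homOfLE h).op))
    (hres : (FlasqueComplex.ofComplex I.obj hI).IsResolution) {k : ℕ}
    (f : S.space 1 ⟶ S.space (k + 1)) (hf : (S.val (k + 1)).comp f.hom = S.val 1) {i : ℤ} (hi : 0 < i)
    (hk : (k : ℤ) ≤ i) : (pushComplex f I).obj.ExactAt i := by
  obtain ⟨q, rfl⟩ : ∃ q : ℕ, i = ((q + 1 : ℕ) : ℤ) := ⟨(i - 1).toNat, by omega⟩
  refine (exactAt_iff_locEx (pushComplex f I).obj (fun m _ _ _ => hI m _) q).2 fun z => ?_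
  change ((FlasqueComplex.ofComplex I.obj hI).pushforward f.hom).LocEx q z
  have hz : S.val (k + 1) z ∉ S.skel (n - (k + 1 : ℕ)) := z.2
  obtain ⟨d, k', hdk, hx⟩ := S.isClosedFiltration.exists_mem_stratum (S.val (k + 1) z)
  -- Points of `U_{k+1}` lie outside `X^{n-k-1}`, so their codimension is at most `k`.
  have hd : (n : ℤ) - (k + 1 : ℕ) < d := by
    by_contra h
    exact hz (S.isClosedFiltration.mono (not_lt.1 h) hx.1)
  refine FlasqueComplex.LocEx.of_comp (S.isOpenEmbedding_val (k + 1)) ?_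
  rw [hf]
  exact FlasqueComplex.locEx_pushforward_regular S.isTopologicalStratification
    (K := FlasqueComplex.ofComplex I.obj hI) hres hdk hx (by omega)

/-- The complexes `P_k` are the derived direct images of `G`. -/
theorem nonempty_deligneStep_iso (p : Perversity)
    (hp : ∀ k : ℕ+, (k : ℕ) ≤ n → (k : ℤ) - 1 ≤ p.toFun k) (G : Sh R (S.space 1))
    (I : CochainComplex.Plus (Sh R (S.space 1))) (hinj : ∀ m, Injective (I.obj.X m))
    (hI : ∀ (q : ℤ) {V W : Opens (S.space 1)} (h : V ≤ W),
      Function.Surjective ((I.obj.X q).obj.map (homOfLE h).op))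
    (hres : (FlasqueComplex.ofComplex I.obj hI).IsResolution)
    (e : DerivedCategory.Plus.Q.obj I ≅ single G) (j : ℕ) (hj : j ≤ n) :
    ∃ f : S.space 1 ⟶ S.space (j + 1), (S.val (j + 1)).comp f.hom = S.val 1 ∧
      Nonempty (deligneStep S p G j ≅ DerivedCategory.Plus.Q.obj (pushComplex f I)) := by
  induction j with
  | zero => exact ⟨𝟙 _, rfl, ⟨e.symm⟩⟩
  | succ j ih =>
    obtain ⟨f, hf, ⟨e'⟩⟩ := ih (by omega)
    have hf' : (S.val (j + 2)).comp (f ≫ S.incl (j + 1)).hom = S.val 1 := hf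
    refine ⟨f ≫ S.incl (j + 1), hf', ?_⟩
    have := injective_pushComplex (S.isOpenEmbedding_of_comp f hf) hinj
    obtain ⟨e₁⟩ := nonempty_derivedPushforward_iso (S.incl (j + 1)) (pushComplex f I)
    have hk := hp j.succPNat hj
    rw [Nat.succPNat_coe] at hk
    -- With `k = j + 1`, a degree above `p k ≥ k - 1` is at least `k`, and positive because `k ≥ 1`;
    -- truncation therefore removes only zero cohomology.
    have hex : ∀ i, p.toFun j.succPNat < i →
        (pushComplex (f ≫ S.incl (j + 1)) I).obj.ExactAt i := fun i hi =>
      exactAt_pushComplex S I hI hres (k := j + 1) _ hf' (by push_cast at hk; omega)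
        (by push_cast at hk ⊢; omega)
    obtain ⟨e₂⟩ := nonempty_truncLE_iso _ _ hex
    exact ⟨(trunc _).mapIso ((derivedPushforward _).mapIso e' ≪≫ e₁) ≪≫ e₂⟩

/-- Isomorphic complexes have isomorphic hypercohomology. -/
noncomputable def hypercohomologyIso {Y : TopCat.{u}} {K K' : DPlus R Y} (e : K ≅ K') (i : ℤ) :
    hypercohomology K i ≅ hypercohomology K' i :=
  (DerivedCategory.Plus.homologyFunctor (ModuleCat.{u} R) i).mapIso
    ((globalSections R Y).rightDerivedFunctorPlus.mapIso e)

theorem nonempty_intersectionCohomology_iso (p : Perversity)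
    (hp : ∀ k : ℕ+, (k : ℕ) ≤ n → (k : ℤ) - 1 ≤ p.toFun k) (G : Sh R (S.space 1))
    (hG : IsLocalSystem G) (i : ℤ) :
    Nonempty (intersectionCohomology S p G i ≅ sheafCohomology G i) := by
  obtain ⟨I, hinj, ⟨e⟩, ⟨e₀⟩, hex⟩ := exists_injective_resolution G
  have hI : ∀ (q : ℤ) {V W : Opens (S.space 1)} (h : V ≤ W),
      Function.Surjective ((I.obj.X q).obj.map (homOfLE h).op) := fun q _ _ h =>
    @surjective_res_of_injective R _ (S.space 1) (I.obj.X q) (hinj q) _ _ h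
  obtain ⟨f, hf, ⟨e'⟩⟩ := nonempty_deligneStep_iso S p hp G I hinj hI
    (hG.isResolution I.obj hI e₀ hex) e n le_rfl
  have hfo := S.isOpenEmbedding_of_comp f hf
  have := injective_pushComplex hfo hinj
  obtain ⟨e₁⟩ := nonempty_derivedPushforward_iso (S.U (n + 1)).inclusion' (pushComplex f I)
  -- The final transport from `U_{n+1}` to `X` is one more direct image of the same injective
  -- complex.
  obtain ⟨e₂⟩ := nonempty_hypercohomology_pushComplex_iso
    (f := f ≫ (S.U (n + 1)).inclusion') ((S.U (n + 1)).isOpenEmbedding.comp hfo) I hinj i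
  exact ⟨hypercohomologyIso ((derivedPushforward _).mapIso e' ≪≫ e₁) i ≪≫ e₂ ≪≫
    hypercohomologyIso e i⟩

end Comparison

end Deligne

open Deligne
theorem corollary3p2 {R : Type u} [CommRing R] [IsNoetherianRing R]
    (hR : FiniteCohomologicalDimension R)
    {n : ℕ} {X : Type u} [TopologicalSpace X] (S : PseudomanifoldStratification n X)
    (p : Perversity) (hp : ∀ k : ℕ+, (k : ℕ) ≤ n → (k : ℤ) - 1 ≤ p.toFun k)
    (G : Sh R (S.space 1)) (hG : IsLocalSystem G) (i : ℤ) :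
    Nonempty (intersectionCohomology S p G i ≅ sheafCohomology G i) := by
  exact nonempty_intersectionCohomology_iso S p hp G hG i
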